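/- **Setting.** Let $d\ge 1$ and $L\ge 1$. Place qubits on the links and checks on the sites of the periodic lattice $(\mathbb Z/L)^d$. A pattern of bit flips $e$ is a $\mathbb Z_2$-valued function on links; its syndrome is its boundary $\partial e$, the sites with $\partial e=1$ host defects, and if $\partial e=0$ its logical action is the bit flip $X^c$ on $d$ logical qubits, where $c\in\mathbb Z_2^d$ is its winding class ($d=1$: the repetition code; $d=2$: one sector of the toric code). **Decoder ($Z=0$, message velocity $v\ge1$).** Each site $x$ stores, for each direction $\pm a$, a message value $m^{\pm a}_x\in\{1,\dots,L\}\cup\{\infty\}$, initially $\infty$. In each time step: (i) the noise flips qubits; (ii) the syndrome is measured (possibly with flipped outcomes); (iii) $v$ times, simultaneously for all sites, $m_x^{\pm a}$ is replaced by $1$ if there is a measured defect at $x\mp\hat a$, and otherwise by $\min\{m_{x'}^{\pm a}+\|x-x'\|_1 : x'_a=x_a\mp 1,\ \|x-x'\|_\infty\le 1\}$, values above $L$ becoming $\infty$; (iv) every defect that receives a message moves one step towards the source of the smallest one (against that message's direction of propagation), degeneracies being resolved by a fixed rule, by a bit flip on the link crossed; a link crossed by defects from both ends is flipped once, so that they annihilate.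 **Noise.** A noise model is the law of a random set $\mathsf N$ of spacetime locations (qubits or measurement bits, at integer times). It is $p$-bounded if $\mathsf P(A\subset\mathsf N)<p^{|A|}$ for every finite non-empty set $A$ of locations. **Memory time.** Start from a code state without errors. The offline decoder $\mathcal D_{\rm off}$ is either the noiseless message-passing decoder started without messages and run until all defects are gone or, if $d=1$, a global majority vote (non-termination and tied votes are not counted as errors). Let $P_t(c)$ be the probability that running the noisy decoder for $t$ steps followed by $\mathcal D_{\rm off}$ leaves the logical operator $X^c$. Then $$t_{\rm mem}=\min\Big\{t:\ \max_{\rho}\Big\|\sum_c P_t(c)X^c\rho X^c-\rho\Big\|_1>\tfrac12\Big\}\in\mathbb N\cup\{\infty\},$$ the maximum being over density matrices of the $d$ logical qubits. There is a threshold at $p_c$ if $\lim_{L\to\infty}t_{\rm mem}=\infty$ for all $0<p<p_c$. **Theorem.** For every dimension $d\ge1$, every velocity $v\ge1$, every degeneracy rule and each of the above offline decoders there are constants $a,b,c>0$ and, for all $p\in(0,1)$ and $L\ge1$, a $p$-bounded noise model, without measurement errors and acting only on the qubits along a single straight line of the lattice, such that for every $p\in(0,1)$ the limit $\lim_{L\to\infty}t_{\rm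 mem}$ exists and $$\lim_{L\to\infty}t_{\rm mem}<a\,e^{\,b/\ln(1/(1-p))}+c ,$$ where $a,b,c$ do not depend on $p$. In particular, under this noise the decoder has no threshold at any $p_c>0$. -/

import Mathlib

open scoped Classical ENNReal Topology ComplexOrder
open MeasureTheory Filter

noncomputable section

namespace MessagePassing

/-! ### The code

Qubits live on the links of the periodic cubic lattice `(ℤ/L)^d`, checks on its sites. A bit-flip
error is a `ℤ₂`-valued 1-chain, its syndrome (the `ℤ₂` defects / anyons) is its boundary, and its
logical action is its winding class. This is the repetition code on a ring for `d = 1`, and one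
sector of the toric code for `d = 2`. -/

/-- Sites of the periodic lattice of linear size `L` in dimension `d`. -/
abbrev Site (d L : ℕ) : Type := Fin d → ZMod L

/-- The link `(x, a)` joins the sites `x` and `x + e_a`. It carries one qubit. -/
abbrev Link (d L : ℕ) : Type := Site d L × Fin d

/-- The oriented lattice directions `± e_a`. -/
abbrev Dir (d : ℕ) : Type := Fin d × ℤˣ

/-- A pattern of bit flips. -/
abbrev Chain (d L : ℕ) : Type := Link d L → ZMod 2

/-- The unit displacement `± e_a`. -/
def Dir.vec {d : ℕ} (L : ℕ) (D : Dir d) : Site d L := Pi.single D.1 (((D.2 : ℤˣ) : ℤ) : ZMod L)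

/-- The opposite direction. -/
def Dir.opp {d : ℕ} (D : Dir d) : Dir d := (D.1, -D.2)

/-- The link crossed when one leaves `x` in direction `D`. -/
def crossedLink {d L : ℕ} (x : Site d L) (D : Dir d) : Link d L :=
  if D.2 = 1 then (x, D.1) else (x + D.vec L, D.1)

/-- The syndrome of a bit-flip pattern: each site adds up the flips on its `2d` links. -/
def syndrome {d L : ℕ} (e : Chain d L) (x : Site d L) : ZMod 2 :=
  ∑ D : Dir d, e (crossedLink x D)

/-- The parity of the flips on links crossing the hyperplane `x_a = 0` in direction `a`. On
patterns with trivial syndrome this is the logical operator that the pattern implements. -/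
def winding {d L : ℕ} [NeZero L] (e : Chain d L) (a : Fin d) : ZMod 2 :=
  ∑ x : Site d L, if x a = 0 then e (x, a) else 0

/-! ### The message-passing decoder without a buffer -/

/-- The messages: `m D x` is the value (time since emission) of the message at `x` that propagates
along `D`; `⊤` means that there is none. -/
abbrev Messages (d L : ℕ) : Type := Dir d → Site d L → ℕ∞

/-- Displacements from `x` to the sites `x'` from which `x` receives messages propagating along `D`:
`‖x' - x‖_∞ ≤ 1` and `‖x' - (x - 2D)‖_∞ ≤ 1`. -/
def backCone {d : ℕ} (D : Dir d) : Finset (Fin d → ℤ) :=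
  (Fintype.piFinset fun _ => Finset.Icc (-1 : ℤ) 1).filter fun δ => δ D.1 = -((D.2 : ℤˣ) : ℤ)

/-- Values larger than the maximal storable value `L` are discarded. -/
def truncate (L : ℕ) (n : ℕ∞) : ℕ∞ := if n ≤ (L : ℕ∞) then n else ⊤

/-- One message step: messages propagate by one site, growing by the 1-norm distance travelled, the
smallest value winning; each defect puts messages of value `1` on its nearest neighbours. -/
def messageStep {d L : ℕ} (σ : Site d L → ZMod 2) (m : Messages d L) : Messages d L :=
  fun D x =>
    if σ (x - D.vec L) = 1 then 1
    else truncate L ((backCone D).inf fun δ =>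
      m D (x + fun b => (δ b : ZMod L)) + ((∑ b, (δ b).natAbs : ℕ) : ℕ∞))

/-- The directions whose messages at `x` have the smallest value (none if there is no message). -/
def minimizers {d L : ℕ} (m : Messages d L) (x : Site d L) : Finset (Dir d) :=
  Finset.univ.filter fun D => m D x ≠ ⊤ ∧ ∀ D', m D x ≤ m D' x

/-- A rule resolving degeneracies between directions. -/
structure TieBreak (d : ℕ) where
  choose : Finset (Dir d) → Dir d
  choose_mem : ∀ S : Finset (Dir d), S.Nonempty → choose S ∈ S

/-- The defect at `x` moves across the link `ℓ`: it moves one step towards the source of the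
smallest message it receives, i.e. against the direction of propagation of that message. -/
def MovesAcross {d L : ℕ} (tie : TieBreak d) (σ : Site d L → ZMod 2) (m : Messages d L)
    (x : Site d L) (ℓ : Link d L) : Prop :=
  σ x = 1 ∧ (minimizers m x).Nonempty ∧ ℓ = crossedLink x (tie.choose (minimizers m x)).opp

/-- The feedback: a flip on each link that is crossed by a defect. Two defects that cross the same
link from both ends meet and annihilate. -/
def feedback {d L : ℕ} (tie : TieBreak d) (σ : Site d L → ZMod 2) (m : Messages d L) : Chain d L :=
  fun ℓ => if ∃ x, MovesAcross tie σ m x ℓ then 1 else 0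

/-- The state of the system: accumulated bit flips on the qubits, and the classical messages. -/
structure State (d L : ℕ) where
  err : Chain d L
  msg : Messages d L

/-- A code state afflicted by the error `e`, with no messages. -/
def State.fresh {d L : ℕ} (e : Chain d L) : State d L := ⟨e, fun _ _ => ⊤⟩

/-- One time step of the noisy decoder with message velocity `v`: the qubits in `q` are flipped, the
syndrome is measured with outcomes flipped on `μ`, the messages make `v` steps, and every
measured defect moves once. -/
def step {d L : ℕ} (v : ℕ) (tie : TieBreak d) (q : Chain d L) (μ : Site d L → ZMod 2)
    (s : State d L) : State d L :=
  let e := s.err + q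
  let σ := syndrome e + μ
  let m := (messageStep σ)^[v] s.msg
  ⟨e + feedback tie σ m, m⟩

/-! ### Noise -/

/-- Spacetime locations of possible faults: a qubit or a measurement bit, and a time. -/
abbrev Loc (d L : ℕ) : Type := (Link d L ⊕ Site d L) × ℕ

/-- The state after `t` time steps with noise realization `N`, started from a code state. -/
def evolve {d L : ℕ} (v : ℕ) (tie : TieBreak d) (N : Set (Loc d L)) : ℕ → State d L
  | 0 => State.fresh 0
  | t + 1 => step v tie (fun ℓ => if (Sum.inl ℓ, t) ∈ N then 1 else 0)
      (fun x => if (Sum.inr x, t) ∈ N then 1 else 0) (evolve v tie N t)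

/-- The law `P` of the noise realization is `p`-bounded. -/
def PBounded {α : Type} (p : ℝ) (P : Measure (Set α)) : Prop :=
  ∀ A : Finset α, A.Nonempty → P {N | (A : Set α) ⊆ N} < ENNReal.ofReal (p ^ A.card)

/-- The qubits on a single straight line of links, at all times. No measurement bits. -/
def lineQubits (d L : ℕ) [NeZero d] : Set (Loc d L) :=
  {u | ∃ x : Site d L, (∀ b : Fin d, b ≠ 0 → x b = 0) ∧ u.1 = Sum.inl (x, 0)}

/-! ### Offline decoding -/

/-- The noiseless message-passing decoder, run for `n` steps from the error `e`. -/
def noiselessRun {d L : ℕ} (v : ℕ) (tie : TieBreak d) (e : Chain d L) (n : ℕ) : State d L :=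
  (step v tie 0 0)^[n] (State.fresh e)

/-- The offline decoders: noiseless message passing until all defects are gone, and global majority
vote (for the repetition code, `d = 1`). -/
inductive Offline
  | messagePassing
  | majorityVote

/-- The logical operator that is left after offline decoding of the error `e`. Message passing that
never removes all defects is, by convention, not counted as a logical error, and neither is
a tied vote. -/
def residualClass {d L : ℕ} [NeZero L] (v : ℕ) (tie : TieBreak d) (e : Chain d L) :
    Offline → Fin d → ZMod 2
  | .messagePassing =>
      if h : ∃ n, syndrome (noiselessRun v tie e n).err = 0 then
        winding (noiselessRun v tie e (Nat.find h)).err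
      else 0
  | .majorityVote =>
      fun _ => if L < 2 * (Finset.univ.filter fun ℓ : Link d L => e ℓ = 1).card then 1 else 0

/-! ### Memory time -/

/-- Operators on the `d` logical qubits. -/
abbrev LogicalOp (d : ℕ) : Type := Matrix (Fin d → ZMod 2) (Fin d → ZMod 2) ℂ

/-- The logical bit flip `X^c`. -/
def logicalX {d : ℕ} (c : Fin d → ZMod 2) : LogicalOp d :=
  Matrix.of fun i j => if i = j + c then 1 else 0

/-- Density matrices. -/
def IsDensity {d : ℕ} (ρ : LogicalOp d) : Prop := ρ.PosSemidef ∧ ρ.trace = 1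

/-- The trace norm: the sum of the singular values. -/
def traceNorm {d : ℕ} (A : LogicalOp d) : ℝ :=
  ∑ i, Real.sqrt ((Matrix.isHermitian_conjTranspose_mul_self A).eigenvalues i)

/-- The logical channel obtained by running the noisy decoder for `t` steps and then decoding
offline: the bit flip `X^c` is applied with the probability that the residual class is `c`. -/
def logicalChannel {d L : ℕ} [NeZero L] (v : ℕ) (tie : TieBreak d) (K : Offline)
    (P : Measure (Set (Loc d L))) (t : ℕ) (ρ : LogicalOp d) : LogicalOp d :=
  ∑ c : Fin d → ZMod 2,
    (((P {N | residualClass v tie (evolve v tie N t).err K = c}).toReal : ℝ) : ℂ) •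
      (logicalX c * ρ * logicalX c)

/-- The memory time: the first time at which the logical channel moves some logical state by more
than `1/2` in trace norm (`⊤` if this never happens). -/
def memoryTime {d L : ℕ} [NeZero L] (v : ℕ) (tie : TieBreak d) (K : Offline)
    (P : Measure (Set (Loc d L))) : ℕ∞ :=
  sInf {T : ℕ∞ | ∃ t : ℕ, T = (t : ℕ∞) ∧
    ∃ ρ : LogicalOp d, IsDensity ρ ∧ 1 / 2 < traceNorm (logicalChannel v tie K P t ρ - ρ)}

/-- A memory with memory time `T p L` at noise strength `p` and linear size `L` has a threshold at
`p_c`. -/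
def HasThresholdAt (T : ℝ → ℕ+ → ℕ∞) (p_c : ℝ) : Prop :=
  ∀ p : ℝ, 0 < p → p < p_c → Tendsto (T p) atTop (𝓝 ⊤)

end MessagePassing

end

/-!
For simplicity, all noise acts on one line of the lattice, and before a signal can get around the
lattice the decoder then acts on that line as in dimension one: a message along the line tells the
distance of the closest past defect whose signal arrives just now, messages that have left the line
are larger, and no defect has to choose between two directions, so that the degeneracy rule plays no
role (`history_le`, `exists_source`, `feedback_line`, `err_eq_lineChain`).

The decoder is fooled by *dimers*: single flipped links, whose two defects annihilate at once but
leave a signal behind. Consider a domain of flipped links whose two ends move outwards. The signals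
that one end receives from the side of the domain have travelled farther than half of the domain's
width. Hence a dimer outside of the domain, at a distance of at most this half-width when its signal
arrives, keeps the end moving outwards for that time step, and a domain with one such dimer for each
end and time step grows at unit speed on both sides (`Supports.pulled_right`,
`Supports.grownLinks_succ`).

The noise is `p`-bounded because of the freedom in its choice (`card_random_pattern_le`). With
`m > 2 / p`, a dimer that is chosen among `m` places has probability less than `p / 2` to be at
a given one. Domains of width less than of order `m` leave fewer choices, about `s / (2 v) + 1` in
time step `s`, but the missing factors multiply to a number exponential in `m` because
`m ^ m / m! ≤ e ^ m` (`pow_le_prod_choices`). This is compensated by choosing the centre of the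
domain uniformly among a number `M` of sites that is exponential in `m`, hence in
`1 / ln (1 / (1 - p))`.

The line is divided into independent blocks of a length of order `M`, each with one domain. After
a time of order `M`, the gaps between the domains are shorter than the domains, with certainty. The
majority of the links is then flipped, and the message-passing decoder closes each gap from its two
ends, since these are closer to each other than to all other defects (`ShortGaps.closedLinks_succ`).
In both cases the logical error `X^c` with `c = (1, 0, …, 0)` results with probability one
(`Layout.residualClass_noise`), and the memory time is at most `n + 2`, whatever the system size.

That the memory time converges as `L → ∞` is arranged by delaying the noise by the difference
between `n + 2` and the memory time without delay (`Layout.memoryTime_delay`), which makes the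
memory time equal to `n + 2` for all large `L`.
-/

noncomputable section

namespace MessagePassing

/-! ### Messages as a record of past defects -/

/-- The messages after `K` message steps from a state without messages, when `σ t` is the measured
syndrome of time step `t` and each time step comprises `v` message steps. -/
def history {d L : ℕ} (v : ℕ) (σ : ℕ → Site d L → ZMod 2) : ℕ → Messages d L
  | 0 => fun _ _ => ⊤
  | K + 1 => messageStep (σ (K / v)) (history v σ K)

lemma history_add_iterate {d L v : ℕ} (hv : 1 ≤ v) (σ : ℕ → Site d L → ZMod 2) (t : ℕ) :
    (messageStep (σ t))^[v] (history v σ (t * v)) = history v σ ((t + 1) * v) := by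
  have h : ∀ i ≤ v, (messageStep (σ t))^[i] (history v σ (t * v)) = history v σ (t * v + i) := by
    intro i
    induction i with
    | zero => intro _; rfl
    | succ i ih =>
      intro hi
      have hdiv : (t * v + i) / v = t := by
        rw [mul_comm, Nat.mul_add_div (by omega), Nat.div_eq_of_lt (by omega), add_zero]
      rw [Function.iterate_succ_apply', ih (by omega), ← add_assoc, history, hdiv]
  rw [h v le_rfl]
  congr 1
  ring

lemma truncate_le {L n : ℕ} {a : ℕ∞} (ha : a ≤ n) (hn : n ≤ L) : truncate L a ≤ n := by
  have : a ≤ (L : ℕ∞) := ha.trans (by exact_mod_cast hn)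
  rw [truncate, if_pos this]
  exact ha

lemma eq_of_truncate_ne_top {L : ℕ} {a : ℕ∞} (h : truncate L a ≠ ⊤) : truncate L a = a := by
  unfold truncate at *
  split_ifs at h ⊢ <;> simp_all

/-- The displacement from a site to the one that sends it messages along `D` in a straight line. -/
def Dir.back {d : ℕ} (D : Dir d) : Fin d → ℤ := Pi.single D.1 (-((D.2 : ℤˣ) : ℤ))

lemma Dir.cast_back {d : ℕ} (L : ℕ) (D : Dir d) :
    (fun b => ((D.back b : ℤ) : ZMod L)) = -D.vec L := by
  funext b
  unfold Dir.back Dir.vec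
  by_cases hb : b = D.1
  · subst hb; simp
  · simp [Pi.single_eq_of_ne hb]

lemma Dir.back_mem {d : ℕ} (D : Dir d) : D.back ∈ backCone D := by
  rw [backCone, Finset.mem_filter, Fintype.mem_piFinset]
  refine ⟨fun b => ?_, by simp [Dir.back]⟩
  unfold Dir.back
  by_cases hb : b = D.1
  · subst hb
    rcases Int.units_eq_one_or D.2 with h | h <;> simp [h]
  · simp [Pi.single_eq_of_ne hb]

lemma Dir.sum_natAbs_back {d : ℕ} (D : Dir d) : ∑ b, (D.back b).natAbs = 1 := by
  rw [Finset.sum_eq_single D.1]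
  · rcases Int.units_eq_one_or D.2 with h | h <;> simp [Dir.back, h]
  · intro b _ hb
    simp [Dir.back, Pi.single_eq_of_ne hb]
  · simp

/-- A defect `n` sites behind `x`, seen `n` message steps ago, bounds the message at `x`. -/
lemma history_le {d L v : ℕ} (σ : ℕ → Site d L → ZMod 2) (D : Dir d) (n : ℕ) :
    ∀ (K : ℕ) (x : Site d L), 1 ≤ n → n ≤ K → n ≤ L →
      σ ((K - n) / v) (x - n • D.vec L) = 1 → history v σ K D x ≤ n := by
  induction n with
  | zero => intro K x h; omega
  | succ n ih =>
    intro K x _ hK hL hσ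
    obtain ⟨K, rfl⟩ : ∃ K', K = K' + 1 := ⟨K - 1, by omega⟩
    rw [history, messageStep]
    split_ifs with h1
    · exact_mod_cast Nat.le_add_left 1 n
    rcases Nat.eq_zero_or_pos n with rfl | hn
    · exfalso
      apply h1
      simpa using hσ
    · refine truncate_le ((Finset.inf_le D.back_mem).trans ?_) hL
      rw [D.cast_back, D.sum_natAbs_back]
      push_cast
      gcongr
      refine ih K _ hn (by omega) (by omega) ?_
      have e1 : K - n = K + 1 - (n + 1) := by omega
      have e2 : x + -D.vec L - n • D.vec L = x - (n + 1) • D.vec L := by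
        rw [add_smul, one_smul]; abel
      rw [e1, e2]
      exact hσ

/-- Every message stems from a defect `j` layers behind `x`, seen `j` message steps ago, where `j`
is at most the value of the message. -/
lemma exists_source {d L v : ℕ} (σ : ℕ → Site d L → ZMod 2) (D : Dir d) :
    ∀ (K : ℕ) (x : Site d L), history v σ K D x ≠ ⊤ →
      ∃ j : ℕ, 1 ≤ j ∧ j ≤ K ∧ (j : ℕ∞) ≤ history v σ K D x ∧
        ∃ Δ : Fin d → ℤ, Δ D.1 = -((D.2 : ℤˣ) : ℤ) * j ∧
          σ ((K - j) / v) (x + fun b => ((Δ b : ℤ) : ZMod L)) = 1 := by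
  intro K
  induction K with
  | zero => intro x h; exact absurd rfl h
  | succ K ih =>
    intro x h
    rw [history, messageStep] at h ⊢
    split_ifs at h ⊢ with h1
    · refine ⟨1, le_rfl, by omega, by simp, D.back, by simp [Dir.back], ?_⟩
      rw [D.cast_back, ← sub_eq_add_neg]
      simpa using h1
    · have htr := eq_of_truncate_ne_top h
      rw [htr] at h ⊢
      obtain ⟨δ, hδ, he⟩ := Finset.exists_mem_eq_inf (backCone D) ⟨_, D.back_mem⟩
        (fun δ => history v σ K D (x + fun b => (δ b : ZMod L)) +
          ((∑ b, (δ b).natAbs : ℕ) : ℕ∞))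
      rw [he] at h ⊢
      obtain ⟨j, hj1, hjK, hj, Δ, hΔ, hs⟩ := ih (x + fun b => (δ b : ZMod L)) (by
        intro ht
        apply h
        rw [ht, top_add])
      have hδ1 : δ D.1 = -((D.2 : ℤˣ) : ℤ) := (Finset.mem_filter.mp hδ).2
      refine ⟨j + 1, by omega, by omega, ?_, δ + Δ, ?_, ?_⟩
      · push_cast
        refine add_le_add hj ?_
        have h2 : (δ D.1).natAbs = 1 := by
          rw [hδ1]
          rcases Int.units_eq_one_or D.2 with h | h <;> simp [h]
        have h3 : (δ D.1).natAbs ≤ ∑ b, (δ b).natAbs :=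
          Finset.single_le_sum (f := fun b => (δ b).natAbs) (fun _ _ => Nat.zero_le _)
            (Finset.mem_univ D.1)
        rw [h2] at h3
        have : ((1 : ℕ) : ℕ∞) ≤ ((∑ b, (δ b).natAbs : ℕ) : ℕ∞) := by exact_mod_cast h3
        simpa using this
      · rw [Pi.add_apply, hδ1, hΔ]
        push_cast
        ring
      · have e1 : K + 1 - (j + 1) = K - j := by omega
        rw [e1, ← hs]
        congr 1
        funext b
        simp [add_assoc]

/-! ### Reduction to one dimension -/

/-- The site with coordinate `w` on the line `x_b = 0` for `b ≠ 0`. -/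
def linePt (d L : ℕ) [NeZero d] (w : ℤ) : Site d L := Pi.single 0 (w : ZMod L)

/-- A set of integers, written as a predicate, that is invariant under translation by `L`. -/
def Periodic (L : ℕ) (F : ℤ → Prop) : Prop :=
  ∀ x y : ℤ, (x : ZMod L) = (y : ZMod L) → (F x ↔ F y)

/-- The bit-flip pattern on the line whose flipped links `(w, w + 1)` are given by `F w`. -/
def lineChain (d L : ℕ) [NeZero d] (F : ℤ → Prop) : Chain d L :=
  fun ℓ => if ℓ.2 = 0 ∧ ∃ w, ℓ.1 = linePt d L w ∧ F w then 1 else 0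

/-- The syndrome on the line whose defects are given by `S`. -/
def lineSyndrome (d L : ℕ) [NeZero d] (S : ℤ → Prop) : Site d L → ZMod 2 :=
  fun x => if ∃ w, x = linePt d L w ∧ S w then 1 else 0

/-- The end points of the pattern `F` of flipped links. -/
def ends (F : ℤ → Prop) (x : ℤ) : Prop := Xor (F x) (F (x - 1))

/-- With the defects of time step `τ` at `S τ`, a signal of velocity `v` emitted at `y` reaches
distance `n` in time step `t`. -/
def Source (S : ℕ → ℤ → Prop) (v t : ℕ) (y : ℤ) (n : ℕ) : Prop :=
  (n - 1) / v ≤ t ∧ S (t - (n - 1) / v) y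

/-- In time step `t`, the closest signal that `x` receives comes from its side `ε`. -/
def Pulled (S : ℕ → ℤ → Prop) (v t : ℕ) (ε : ℤˣ) (x : ℤ) : Prop :=
  ∃ B : ℕ, (∃ n : ℕ, 1 ≤ n ∧ n ≤ B ∧ Source S v t (x + (ε : ℤ) * n) n) ∧
    ∀ n : ℕ, 1 ≤ n → Source S v t (x - (ε : ℤ) * n) n → B < n

/-- In time step `t`, no signal reaches `x`. -/
def Quiet (S : ℕ → ℤ → Prop) (v t : ℕ) (x : ℤ) : Prop :=
  ∀ n : ℕ, 1 ≤ n → ∀ ε : ℤˣ, ¬ Source S v t (x + (ε : ℤ) * n) n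

/-- The links of the line that are crossed by a defect in time step `t`. -/
def Crossed (S : ℕ → ℤ → Prop) (v t : ℕ) (x : ℤ) : Prop :=
  (S t x ∧ Pulled S v t 1 x) ∨ (S t (x + 1) ∧ Pulled S v t (-1) (x + 1))

section

variable {d L : ℕ} [NeZero d]

lemma linePt_inj {x y : ℤ} : linePt d L x = linePt d L y ↔ (x : ZMod L) = (y : ZMod L) := by
  unfold linePt
  exact (Pi.single_injective (M := fun _ : Fin d => ZMod L) 0).eq_iff

lemma linePt_add_vec (x : ℤ) (ε : ℤˣ) :
    linePt d L x + Dir.vec L ((0, ε) : Dir d) = linePt d L (x + (ε : ℤ)) := by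
  unfold linePt Dir.vec
  simp [Pi.single_add]

lemma lineChain_linePt {F : ℤ → Prop} (hF : Periodic L F) (w : ℤ) :
    lineChain d L F (linePt d L w, 0) = if F w then 1 else 0 := by
  unfold lineChain
  congr 1
  simp only [true_and, eq_iff_iff]
  constructor
  · rintro ⟨u, hu, h⟩
    exact (hF _ _ (linePt_inj.mp hu)).mpr h
  · intro h
    exact ⟨w, rfl, h⟩

lemma lineSyndrome_linePt {S : ℤ → Prop} (hS : Periodic L S) (w : ℤ) :
    lineSyndrome d L S (linePt d L w) = 1 ↔ S w := by
  unfold lineSyndrome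
  constructor
  · intro h
    split_ifs at h with h1
    · obtain ⟨u, hu, h⟩ := h1
      exact (hS _ _ (linePt_inj.mp hu)).mpr h
    · exact absurd h (by decide)
  · intro h
    rw [if_pos ⟨w, rfl, h⟩]

lemma lineSyndrome_eq_one {S : ℤ → Prop} {x : Site d L} :
    lineSyndrome d L S x = 1 ↔ ∃ w, x = linePt d L w ∧ S w := by
  unfold lineSyndrome
  constructor
  · intro h
    by_contra h1
    rw [if_neg h1] at h
    exact absurd h (by decide)
  · intro h
    rw [if_pos h]

lemma Periodic.ends {F : ℤ → Prop} (hF : Periodic L F) : Periodic L (ends F) := by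
  intro x y h
  unfold MessagePassing.ends
  rw [hF x y h, hF (x - 1) (y - 1) (by push_cast; rw [h])]

lemma Periodic.source {S : ℕ → ℤ → Prop} (hS : ∀ t, Periodic L (S t)) (v t n : ℕ) :
    Periodic L (fun y => Source S v t y n) := by
  intro x y h
  unfold Source
  simp only [hS _ x y h]

lemma Periodic.pulled {S : ℕ → ℤ → Prop} (hS : ∀ t, Periodic L (S t)) (v t : ℕ) (ε : ℤˣ) :
    Periodic L (Pulled S v t ε) := by
  intro x y h
  unfold Pulled
  have h1 : ∀ n : ℕ, Source S v t (x + (ε : ℤ) * n) n ↔ Source S v t (y + (ε : ℤ) * n) n :=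
    fun n => Periodic.source hS v t n _ _ (by push_cast; rw [h])
  have h2 : ∀ n : ℕ, Source S v t (x - (ε : ℤ) * n) n ↔ Source S v t (y - (ε : ℤ) * n) n :=
    fun n => Periodic.source hS v t n _ _ (by push_cast; rw [h])
  simp only [h1, h2]

lemma Periodic.crossed {S : ℕ → ℤ → Prop} (hS : ∀ t, Periodic L (S t)) (v t : ℕ) :
    Periodic L (Crossed S v t) := by
  intro x y h
  have h1 : ((x + 1 : ℤ) : ZMod L) = ((y + 1 : ℤ) : ZMod L) := by push_cast; rw [h]
  unfold Crossed
  rw [hS _ x y h, hS _ _ _ h1, Periodic.pulled hS v t 1 x y h, Periodic.pulled hS v t _ _ _ h1]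

lemma lineChain_add {F Q : ℤ → Prop} (hF : Periodic L F) (hQ : Periodic L Q) :
    lineChain d L F + lineChain d L Q = lineChain d L (fun x => Xor (F x) (Q x)) := by
  have hX : Periodic L (fun x => Xor (F x) (Q x)) := by
    intro x y h
    simp only [hF x y h, hQ x y h]
  funext ⟨x, a⟩
  by_cases h : a = 0 ∧ ∃ w, x = linePt d L w
  · obtain ⟨rfl, w, rfl⟩ := h
    rw [Pi.add_apply, lineChain_linePt hF, lineChain_linePt hQ, lineChain_linePt hX]
    by_cases h1 : F w <;> by_cases h2 : Q w <;> simp [h1, h2, Xor]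
    decide
  · have h' : ∀ F : ℤ → Prop, lineChain d L F (x, a) = 0 := by
      intro F
      exact if_neg fun ⟨h1, w, hw, _⟩ => h ⟨h1, w, hw⟩
    simp [h']

lemma syndrome_lineChain {F : ℤ → Prop} (hF : Periodic L F) :
    syndrome (lineChain d L F) = lineSyndrome d L (ends F) := by
  funext x
  have hsum : syndrome (lineChain d L F) x =
      lineChain d L F (x, 0) + lineChain d L F (x + Dir.vec L ((0, -1) : Dir d), 0) := by
    unfold syndrome
    rw [Fintype.sum_prod_type, Finset.sum_eq_single 0]
    · have hne : (1 : ℤˣ) ∉ ({-1} : Finset ℤˣ) := by decide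
      rw [UnitsInt.univ, Finset.sum_insert hne, Finset.sum_singleton]
      have h1 : ¬ ((-1 : ℤˣ) = 1) := by decide
      simp [crossedLink, h1]
    · intro a _ ha
      refine Finset.sum_eq_zero fun ε _ => ?_
      refine if_neg fun h => ha ?_
      rw [← h.1]
      unfold crossedLink
      split_ifs <;> rfl
    · simp
  rw [hsum]
  by_cases h : ∃ w, x = linePt d L w
  · obtain ⟨w, rfl⟩ := h
    rw [linePt_add_vec, lineChain_linePt hF, lineChain_linePt hF]
    have h2 := lineSyndrome_linePt (d := d) hF.ends w
    have h3 : ends F w ↔ Xor (F w) (F (w - 1)) := Iff.rfl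
    have h4 : (w + ((-1 : ℤˣ) : ℤ)) = w - 1 := by simp [sub_eq_add_neg]
    rw [h4]
    by_cases hE : ends F w
    · rw [h2.mpr hE]
      by_cases ha : F w <;> by_cases hb : F (w - 1) <;> simp_all [Xor]
    · have : lineSyndrome d L (ends F) (linePt d L w) = 0 := by
        rw [lineSyndrome, if_neg]
        intro h5
        exact hE (h2.mp (if_pos h5))
      rw [this]
      by_cases ha : F w <;> by_cases hb : F (w - 1) <;> simp_all [Xor]
      decide
  · have h0 : lineSyndrome d L (ends F) x = 0 := if_neg fun ⟨w, hw, _⟩ => h ⟨w, hw⟩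
    have h1 : lineChain d L F (x, 0) = 0 := if_neg fun ⟨_, w, hw, _⟩ => h ⟨w, hw⟩
    have h2 : lineChain d L F (x + Dir.vec L ((0, -1) : Dir d), 0) = 0 := by
      refine if_neg fun ⟨_, w, hw, _⟩ => h ⟨w + 1, ?_⟩
      have h5 : x + Dir.vec L ((0, -1) : Dir d) = linePt d L w := hw
      have h6 : linePt d L w + Dir.vec L ((0, 1) : Dir d) = linePt d L (w + 1) := by
        simpa using linePt_add_vec (d := d) (L := L) w 1
      rw [← h6, ← h5, add_assoc]
      simp [Dir.vec, ← Pi.single_add]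
    rw [h0, h1, h2, add_zero]

lemma sub_div_eq_sub_div {v t n : ℕ} (hv : 1 ≤ v) (h1 : 1 ≤ n) (hn : n ≤ (t + 1) * v) :
    ((t + 1) * v - n) / v = t - (n - 1) / v := by
  obtain ⟨k, rfl⟩ : ∃ k, n = k + 1 := ⟨n - 1, by omega⟩
  have hk : k / v ≤ t := by
    have : k / v < t + 1 := (Nat.div_lt_iff_lt_mul (by omega)).mpr (by omega)
    omega
  have h2 := Nat.div_add_mod k v
  have h3 := Nat.mod_lt k (show v > 0 by omega)
  simp only [Nat.add_sub_cancel]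
  obtain ⟨u, hu⟩ : ∃ u, t = k / v + u := ⟨t - k / v, by omega⟩
  set q := k / v
  have h4 : (t + 1) * v = v * q + u * v + v := by rw [hu]; ring
  apply Nat.div_eq_of_lt_le
  · have : (t - q) * v = u * v := by rw [hu]; simp
    omega
  · have : (t - q + 1) * v = u * v + v := by rw [hu]; simp; ring
    omega

variable {v t : ℕ} {S : ℕ → ℤ → Prop}

/-- Within `L` message steps a message that propagates across the line does not get around the
lattice and back to the line. -/
lemma history_transverse (hL : (t + 1) * v < L) {D : Dir d} (hD : D.1 ≠ 0) (x : ℤ) :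
    history v (fun τ => lineSyndrome d L (S τ)) ((t + 1) * v) D (linePt d L x) = ⊤ := by
  by_contra h
  obtain ⟨j, hj1, hjK, -, Δ, hΔ, hs⟩ := exists_source _ D _ _ h
  obtain ⟨w, hw, -⟩ := lineSyndrome_eq_one.mp hs
  have h1 := congrFun hw D.1
  simp only [linePt, Pi.add_apply, Pi.single_eq_of_ne hD, zero_add, hΔ] at h1
  have h2 : ((j : ℕ) : ZMod L) = 0 := by
    rcases Int.units_eq_one_or D.2 with h | h <;> simpa [h] using h1
  have h3 := Nat.le_of_dvd (by omega) ((ZMod.natCast_eq_zero_iff _ _).mp h2)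
  omega

lemma history_le_of_source (hv : 1 ≤ v) (hS : ∀ t, Periodic L (S t)) (hL : (t + 1) * v < L)
    {ε : ℤˣ} {x : ℤ} {n : ℕ} (hn : 1 ≤ n) (h : Source S v t (x - (ε : ℤ) * n) n) :
    history v (fun τ => lineSyndrome d L (S τ)) ((t + 1) * v) (0, ε) (linePt d L x) ≤ n := by
  have hnK : n ≤ (t + 1) * v := by
    have := (Nat.div_lt_iff_lt_mul (show 0 < v by omega)).mp (Nat.lt_succ_of_le h.1)
    have h2 : (t + 1) * v = (t).succ * v := rfl
    omega
  refine history_le _ _ n _ _ hn hnK (by omega) ?_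
  rw [sub_div_eq_sub_div hv hn hnK]
  have e : linePt d L x - n • Dir.vec L ((0, ε) : Dir d) = linePt d L (x - (ε : ℤ) * n) := by
    unfold linePt Dir.vec
    rw [← Pi.single_smul, ← Pi.single_sub]
    congr 1
    push_cast
    rw [nsmul_eq_mul, mul_comm]
  rw [e, lineSyndrome_linePt (hS _)]
  exact h.2

lemma exists_source_on_line (hv : 1 ≤ v) (hS : ∀ t, Periodic L (S t))
    {ε : ℤˣ} {x : ℤ}
    (h : history v (fun τ => lineSyndrome d L (S τ)) ((t + 1) * v) (0, ε) (linePt d L x) ≠ ⊤) :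
    ∃ n : ℕ, 1 ≤ n ∧ Source S v t (x - (ε : ℤ) * n) n ∧
      (n : ℕ∞) ≤ history v (fun τ => lineSyndrome d L (S τ)) ((t + 1) * v) (0, ε)
        (linePt d L x) := by
  obtain ⟨n, hn, hnK, hle, Δ, hΔ, hs⟩ := exists_source _ _ _ _ h
  refine ⟨n, hn, ?_, hle⟩
  rw [sub_div_eq_sub_div hv hn hnK] at hs
  obtain ⟨w, hw, hSw⟩ := lineSyndrome_eq_one.mp hs
  refine ⟨?_, (hS _ w _ ?_).mp hSw⟩
  · have : (n - 1) / v < t + 1 := (Nat.div_lt_iff_lt_mul (by omega)).mpr (by omega)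
    omega
  · have h1 := congrFun hw 0
    simp only [linePt, Pi.add_apply, Pi.single_eq_same] at h1
    simp only at hΔ
    rw [← h1, hΔ]
    push_cast
    ring

lemma minimizers_of_pulled (hv : 1 ≤ v) (hS : ∀ t, Periodic L (S t)) (hL : (t + 1) * v < L)
    {ε : ℤˣ} {x : ℤ} (h : Pulled S v t ε x) :
    minimizers (history v (fun τ => lineSyndrome d L (S τ)) ((t + 1) * v)) (linePt d L x) =
      {((0, -ε) : Dir d)} := by
  obtain ⟨B, ⟨n, hn, hnB, hsrc⟩, hfar⟩ := h
  set m := history v (fun τ => lineSyndrome d L (S τ)) ((t + 1) * v)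
  have h1 : m (0, -ε) (linePt d L x) ≤ B := by
    refine (history_le_of_source hv hS hL (ε := -ε) hn ?_).trans (by exact_mod_cast hnB)
    convert hsrc using 1
    push_cast
    ring
  have h2 : ∀ D : Dir d, D ≠ (0, -ε) → (B : ℕ∞) < m D (linePt d L x) := by
    rintro ⟨a, η⟩ hD
    by_cases ha : a = 0
    · subst ha
      have hη : η = ε := by
        rcases Int.units_eq_one_or η with h | h <;> rcases Int.units_eq_one_or ε with h' | h' <;>
          simp_all
      subst hη
      by_cases htop : m (0, η) (linePt d L x) = ⊤
      · rw [htop]; exact ENat.natCast_lt_top B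
      · obtain ⟨n, hn, hs, hle⟩ := exists_source_on_line hv hS htop
        exact lt_of_lt_of_le (by exact_mod_cast hfar n hn hs) hle
    · rw [show m (a, η) (linePt d L x) = ⊤ from history_transverse hL ha x]
      exact ENat.natCast_lt_top B
  ext D
  simp only [minimizers, Finset.mem_filter, Finset.mem_univ, true_and, Finset.mem_singleton]
  constructor
  · rintro ⟨-, hD⟩
    by_contra hne
    exact absurd ((hD (0, -ε)).trans h1) (not_le.mpr (h2 D hne))
  · rintro rfl
    refine ⟨ne_top_of_le_ne_top (ENat.natCast_ne_top B) h1, fun D' => ?_⟩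
    by_cases hD' : D' = (0, -ε)
    · rw [hD']
    · exact h1.trans (h2 D' hD').le

lemma minimizers_of_quiet (hv : 1 ≤ v) (hS : ∀ t, Periodic L (S t)) (hL : (t + 1) * v < L)
    {x : ℤ} (h : Quiet S v t x) :
    minimizers (history v (fun τ => lineSyndrome d L (S τ)) ((t + 1) * v)) (linePt d L x) = ∅ := by
  refine Finset.filter_eq_empty_iff.mpr ?_
  rintro ⟨a, ε⟩ - ⟨hne, -⟩
  by_cases ha : a = 0
  · subst ha
    obtain ⟨n, hn, hs, -⟩ := exists_source_on_line hv hS hne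
    refine h n hn (-ε) ?_
    convert hs using 1
    push_cast
    ring
  · exact hne (history_transverse hL ha x)

lemma movesAcross_of_pulled (hv : 1 ≤ v) (hS : ∀ t, Periodic L (S t)) (hL : (t + 1) * v < L)
    (tie : TieBreak d) {ε : ℤˣ} {x : ℤ} (h : Pulled S v t ε x) (ℓ : Link d L) :
    MovesAcross tie (lineSyndrome d L (S t))
        (history v (fun τ => lineSyndrome d L (S τ)) ((t + 1) * v)) (linePt d L x) ℓ ↔
      S t x ∧ ℓ = (linePt d L (if ε = 1 then x else x - 1), 0) := by
  unfold MovesAcross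
  rw [minimizers_of_pulled hv hS hL h, lineSyndrome_linePt (hS t)]
  have hc := tie.choose_mem {((0, -ε) : Dir d)} ⟨_, Finset.mem_singleton_self _⟩
  rw [Finset.mem_singleton] at hc
  rw [hc]
  have hcl : crossedLink (linePt d L x) (Dir.opp ((0, -ε) : Dir d)) =
      (linePt d L (if ε = 1 then x else x - 1), 0) := by
    unfold crossedLink Dir.opp
    simp only [neg_neg]
    split_ifs with h1
    · rfl
    · have h2 : ε = -1 := (Int.units_eq_one_or ε).resolve_left h1
      subst h2
      rw [linePt_add_vec]
      rfl
  rw [hcl]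
  simp

/-- If each defect either has a well-defined closest signal or receives none, then the feedback
flips the crossed links of the line, whatever the rule for degeneracies. -/
lemma feedback_line (hv : 1 ≤ v) (hS : ∀ t, Periodic L (S t)) (hL : (t + 1) * v < L)
    (tie : TieBreak d)
    (htri : ∀ x, S t x → Pulled S v t 1 x ∨ Pulled S v t (-1) x ∨ Quiet S v t x) :
    feedback tie (lineSyndrome d L (S t))
        (history v (fun τ => lineSyndrome d L (S τ)) ((t + 1) * v)) =
      lineChain d L (Crossed S v t) := by
  funext ℓ
  unfold feedback lineChain
  congr 1
  rw [eq_iff_iff]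
  have hneg : ¬ ((-1 : ℤˣ) = 1) := by decide
  constructor
  · rintro ⟨y, hy⟩
    obtain ⟨x, rfl, hx⟩ := lineSyndrome_eq_one.mp hy.1
    rcases htri x hx with h | h | h
    · rw [movesAcross_of_pulled hv hS hL tie h] at hy
      rw [hy.2]
      exact ⟨rfl, x, by simp, Or.inl ⟨hx, h⟩⟩
    · rw [movesAcross_of_pulled hv hS hL tie h] at hy
      rw [hy.2]
      exact ⟨rfl, x - 1, by simp [hneg], Or.inr (by simpa using ⟨hx, h⟩)⟩
    · have := hy.2.1
      rw [minimizers_of_quiet hv hS hL h] at this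
      simp at this
  · rcases ℓ with ⟨y, a⟩
    rintro ⟨h0, w, hw, h | h⟩
    · simp only at h0 hw
      subst h0 hw
      exact ⟨linePt d L w, (movesAcross_of_pulled hv hS hL tie h.2 _).mpr ⟨h.1, by simp⟩⟩
    · simp only at h0 hw
      subst h0 hw
      exact ⟨linePt d L (w + 1),
        (movesAcross_of_pulled hv hS hL tie h.2 _).mpr ⟨h.1, by simp [hneg]⟩⟩

end

/-- One-dimensional description of a run of the decoder: `F t` are the flipped links of the line at
time `t`, `Q t` the links that are hit by noise, `G t` the flipped links after the noise. -/
lemma err_eq_lineChain {d L : ℕ} [NeZero d] {v T : ℕ} (hv : 1 ≤ v) (hL : T * v < L)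
    (tie : TieBreak d) {F Q G : ℕ → ℤ → Prop} (hF : ∀ t, Periodic L (F t))
    (hQ : ∀ t, Periodic L (Q t)) (hG : ∀ t x, G t x ↔ Xor (F t x) (Q t x))
    {s : ℕ → State d L} (hs0 : s 0 = State.fresh (lineChain d L (F 0)))
    (hs : ∀ t < T, s (t + 1) = step v tie (lineChain d L (Q t)) 0 (s t))
    (htri : ∀ t < T, ∀ x, ends (G t) x → Pulled (fun τ => ends (G τ)) v t 1 x ∨
      Pulled (fun τ => ends (G τ)) v t (-1) x ∨ Quiet (fun τ => ends (G τ)) v t x)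
    (hstep : ∀ t < T, ∀ x, F (t + 1) x ↔
      Xor (G t x) (Crossed (fun τ => ends (G τ)) v t x)) :
    ∀ t ≤ T, (s t).err = lineChain d L (F t) := by
  have hG' : ∀ t, G t = fun x => Xor (F t x) (Q t x) := fun t => funext fun x => propext (hG t x)
  have hGp : ∀ t, Periodic L (G t) := by
    intro t x y h
    rw [hG, hG, hF t x y h, hQ t x y h]
  set S : ℕ → ℤ → Prop := fun τ => ends (G τ) with hSdef
  have hS : ∀ t, Periodic L (S t) := fun t => (hGp t).ends
  have key : ∀ t ≤ T, (s t).err = lineChain d L (F t) ∧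
      (s t).msg = history v (fun τ => lineSyndrome d L (S τ)) (t * v) := by
    intro t
    induction t with
    | zero =>
      intro _
      rw [hs0]
      refine ⟨rfl, ?_⟩
      rw [zero_mul]
      rfl
    | succ t ih =>
      intro ht
      obtain ⟨he, hm⟩ := ih (by omega)
      have hLt : (t + 1) * v < L := lt_of_le_of_lt (Nat.mul_le_mul_right v ht) hL
      have hg : (s t).err + lineChain d L (Q t) = lineChain d L (G t) := by
        rw [he, lineChain_add (hF t) (hQ t), hG' t]
      have hsyn : syndrome (lineChain d L (G t)) + 0 = lineSyndrome d L (S t) := by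
        rw [add_zero, syndrome_lineChain (hGp t)]
      rw [hs t (by omega)]
      unfold step
      simp only [hg, hsyn, hm]
      rw [history_add_iterate hv (fun τ => lineSyndrome d L (S τ)) t]
      refine ⟨?_, rfl⟩
      rw [feedback_line hv hS hLt tie (htri t (by omega)),
        lineChain_add (hGp t) (Periodic.crossed hS v t)]
      congr 1
      funext x
      exact propext (hstep t (by omega) x).symm
  exact fun t ht => (key t ht).1

lemma Pulled.not_neg {S : ℕ → ℤ → Prop} {v t : ℕ} {x : ℤ} (h : Pulled S v t 1 x) :
    ¬ Pulled S v t (-1) x := by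
  rintro ⟨B', ⟨n', hn', hB', hs'⟩, hf'⟩
  obtain ⟨B, ⟨n, hn, hB, hs⟩, hf⟩ := h
  have h1 := hf n' hn' (by simpa [sub_eq_add_neg] using hs')
  have h2 := hf' n hn (by simpa [sub_eq_add_neg] using hs)
  omega

/-! ### Growth of supported domains -/

/-- The half-width at time `t` of a domain of flipped links that is created at time `2` with
half-width `2 * v + 1`, the smallest one that dimers two time steps old can support, and whose two
ends move outwards in each time step. -/
def halfWidth (v t : ℕ) : ℤ := 2 * v - 1 + t

/-- The links in the domains of half-width `h` around the centres `c i`. -/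
def domains (c : ℤ → ℤ) (h : ℤ) (w : ℤ) : Prop := ∃ i, c i - h ≤ w ∧ w < c i + h

/-- A schedule `D t` of dimers (single flipped links) that supports the growth of the domains around
the centres `c i`, each domain staying within distance `R` of its centre, up to time `T`. For each
end and each time step there is a dimer whose signal arrives just then, after a distance `n` of at
most the half-width; the dimers are so isolated that they annihilate at once. -/
structure Supports (v T : ℕ) (c : ℤ → ℤ) (R : ℤ) (D : ℕ → ℤ → Prop) : Prop where
  sep : ∀ i j, i < j → c i + 2 * R ≤ c j
  halfWidth_le : halfWidth v T + 5 ≤ R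
  mem_gap : ∀ t w, D t w → ∃ i, (c i + halfWidth v t + 5 ≤ w ∧ w ≤ c i + R - 5) ∨
    (c i - R + 5 ≤ w ∧ w ≤ c i - halfWidth v t - 6)
  isolated : ∀ t w w', D t w → D t w' → w < w' → w + 4 ≤ w'
  right : ∀ t, 2 ≤ t → t < T → ∀ i, ∃ n : ℕ, 1 ≤ n ∧ n ≤ halfWidth v t ∧ (n - 1) / v ≤ t ∧
    D (t - (n - 1) / v) (c i + halfWidth v t + n)
  left : ∀ t, 2 ≤ t → t < T → ∀ i, ∃ n : ℕ, 1 ≤ n ∧ n ≤ halfWidth v t ∧ (n - 1) / v ≤ t ∧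
    D (t - (n - 1) / v) (c i - halfWidth v t - n - 1)

/-- The links that are flipped after the noise of time step `t`. -/
def noisyLinks (v : ℕ) (c : ℤ → ℤ) (D : ℕ → ℤ → Prop) (t : ℕ) (w : ℤ) : Prop :=
  (2 ≤ t ∧ domains c (halfWidth v t) w) ∨ D t w

/-- The links that are flipped at time `t`, before the noise. -/
def grownLinks (v : ℕ) (c : ℤ → ℤ) (t : ℕ) (w : ℤ) : Prop :=
  3 ≤ t ∧ domains c (halfWidth v t) w

/-- The links that are hit by the noise of time step `t`. -/
def noiseLinks (v : ℕ) (c : ℤ → ℤ) (D : ℕ → ℤ → Prop) (t : ℕ) (w : ℤ) : Prop :=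
  (t = 2 ∧ domains c (halfWidth v t) w) ∨ D t w

namespace Supports

variable {v T : ℕ} {c : ℤ → ℤ} {R : ℤ} {D : ℕ → ℤ → Prop}

lemma halfWidth_mono {s t : ℕ} (h : s ≤ t) : halfWidth v s ≤ halfWidth v t := by
  unfold halfWidth; omega

lemma sep_cases (hS : Supports v T c R D) (i j : ℤ) :
    i = j ∨ c i + 2 * R ≤ c j ∨ c j + 2 * R ≤ c i := by
  rcases lt_trichotomy i j with h | h | h
  · exact Or.inr (Or.inl (hS.sep i j h))
  · exact Or.inl h
  · exact Or.inr (Or.inr (hS.sep j i h))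

lemma halfWidth_le_of_le (hS : Supports v T c R D) {t : ℕ} (ht : t ≤ T) :
    halfWidth v t + 5 ≤ R := by
  have := hS.halfWidth_le
  have := halfWidth_mono (v := v) ht
  omega

lemma halfWidth_le_of_mem (hS : Supports v T c R D) {t : ℕ} {w : ℤ} (h : D t w) :
    halfWidth v t + 10 ≤ R := by
  obtain ⟨i, h⟩ := hS.mem_gap t w h
  omega

lemma noisyLinks_near_dimer (hS : Supports v T c R D) {t : ℕ} {w u : ℤ} (h : D t w)
    (h1 : w - 2 ≤ u) (h2 : u ≤ w + 2) : noisyLinks v c D t u ↔ u = w := by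
  constructor
  · rintro (⟨-, j, hj⟩ | hu)
    · obtain ⟨i, hi⟩ := hS.mem_gap t w h
      have := hS.halfWidth_le_of_mem h
      rcases hS.sep_cases i j with rfl | h' | h' <;> omega
    · by_contra hne
      rcases lt_or_gt_of_ne hne with h' | h'
      · have := hS.isolated t _ _ hu h h'; omega
      · have := hS.isolated t _ _ h hu h'; omega
  · rintro rfl
    exact Or.inr h

lemma ends_dimer (hS : Supports v T c R D) {t : ℕ} {w : ℤ} (h : D t w) :
    ends (noisyLinks v c D t) w ∧ ends (noisyLinks v c D t) (w + 1) := by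
  have h0 : noisyLinks v c D t w := Or.inr h
  constructor
  · refine Or.inl ⟨h0, fun h1 => ?_⟩
    have := (hS.noisyLinks_near_dimer h (by omega) (by omega)).mp h1
    omega
  · refine Or.inr ⟨by simpa using h0, fun h1 => ?_⟩
    have := (hS.noisyLinks_near_dimer h (by omega) (by omega)).mp h1
    omega

lemma pulled_dimer (hS : Supports v T c R D) {t : ℕ} {w : ℤ} (h : D t w) :
    Pulled (fun τ => ends (noisyLinks v c D τ)) v t 1 w := by
  refine ⟨1, ⟨1, le_rfl, le_rfl, ?_⟩, ?_⟩
  · simpa [Source] using (hS.ends_dimer h).2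
  · intro n hn hs
    by_contra hlt
    obtain rfl : n = 1 := by omega
    have h1 : ends (noisyLinks v c D t) (w - 1) := by simpa [Source] using hs
    rcases h1 with ⟨h1, -⟩ | ⟨h1, -⟩
    · have := (hS.noisyLinks_near_dimer h (by omega) (by omega)).mp h1
      omega
    · have := (hS.noisyLinks_near_dimer h (by omega) (by omega)).mp h1
      omega

lemma pulled_dimer' (hS : Supports v T c R D) {t : ℕ} {w : ℤ} (h : D t w) :
    Pulled (fun τ => ends (noisyLinks v c D τ)) v t (-1) (w + 1) := by
  refine ⟨1, ⟨1, le_rfl, le_rfl, ?_⟩, ?_⟩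
  · simpa [Source] using (hS.ends_dimer h).1
  · intro n hn hs
    by_contra hlt
    obtain rfl : n = 1 := by omega
    have h1 : ends (noisyLinks v c D t) (w + 1 + 1) := by simpa [Source] using hs
    rcases h1 with ⟨h1, -⟩ | ⟨h1, -⟩
    · have := (hS.noisyLinks_near_dimer h (by omega) (by omega)).mp h1
      omega
    · have := (hS.noisyLinks_near_dimer h (by omega) (by omega)).mp h1
      omega

/-- There are no defects strictly inside a domain (or inside the place of a future domain). -/
lemma outside_of_ends (hS : Supports v T c R D) {t : ℕ} {x : ℤ}
    (h : ends (noisyLinks v c D t) x) (i : ℤ) :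
    x ≤ c i - halfWidth v t ∨ c i + halfWidth v t ≤ x := by
  by_contra! hcon
  have hD : ∀ w, c i - halfWidth v t ≤ w → w < c i + halfWidth v t → ¬ D t w := by
    intro w h1 h2 hw
    obtain ⟨j, hj⟩ := hS.mem_gap t w hw
    have := hS.halfWidth_le_of_mem hw
    rcases hS.sep_cases i j with rfl | h' | h' <;> omega
  have hG : ∀ w, c i - halfWidth v t ≤ w → w < c i + halfWidth v t →
      (noisyLinks v c D t w ↔ 2 ≤ t) := by
    intro w h1 h2
    constructor
    · rintro (h3 | h3)
      · exact h3.1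
      · exact absurd h3 (hD w h1 h2)
    · intro h3
      exact Or.inl ⟨h3, i, h1, h2⟩
  have h1 := hG x (by omega) (by omega)
  have h2 := hG (x - 1) (by omega) (by omega)
  unfold ends at h
  rw [h1, h2, xor_self] at h
  exact h

/-- Signals that reach an end of a domain from the domain's side have travelled farther than its
half-width: an end never outruns the signals from the other end by more than that. -/
lemma lt_of_source_right (hS : Supports v T c R D) {t : ℕ} {i : ℤ} {n : ℕ}
    (hn : 1 ≤ n)
    (h : Source (fun τ => ends (noisyLinks v c D τ)) v t (c i + halfWidth v t - n) n) :
    halfWidth v t < n := by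
  obtain ⟨hk, he⟩ := h
  have h1 := hS.outside_of_ends he i
  have h2 := Nat.div_le_self (n - 1) v
  unfold halfWidth at *
  push_cast [Nat.cast_sub hk] at h1
  omega

lemma lt_of_source_left (hS : Supports v T c R D) {t : ℕ} {i : ℤ} {n : ℕ}
    (hn : 1 ≤ n)
    (h : Source (fun τ => ends (noisyLinks v c D τ)) v t (c i - halfWidth v t + n) n) :
    halfWidth v t < n := by
  obtain ⟨hk, he⟩ := h
  have h1 := hS.outside_of_ends he i
  have h2 := Nat.div_le_self (n - 1) v
  unfold halfWidth at *
  push_cast [Nat.cast_sub hk] at h1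
  omega

lemma pulled_right (hS : Supports v T c R D) {t : ℕ} (h2 : 2 ≤ t) (ht : t < T) (i : ℤ) :
    Pulled (fun τ => ends (noisyLinks v c D τ)) v t 1 (c i + halfWidth v t) := by
  obtain ⟨n, hn1, hn2, hk, hd⟩ := hS.right t h2 ht i
  refine ⟨(halfWidth v t).toNat, ⟨n, hn1, by omega, hk, ?_⟩, ?_⟩
  · simpa using (hS.ends_dimer hd).1
  · intro n hn hs
    have := hS.lt_of_source_right hn (i := i) (by simpa using hs)
    omega

lemma pulled_left (hS : Supports v T c R D) {t : ℕ} (h2 : 2 ≤ t) (ht : t < T) (i : ℤ) :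
    Pulled (fun τ => ends (noisyLinks v c D τ)) v t (-1) (c i - halfWidth v t) := by
  obtain ⟨n, hn1, hn2, hk, hd⟩ := hS.left t h2 ht i
  refine ⟨(halfWidth v t).toNat, ⟨n, hn1, by omega, hk, ?_⟩, ?_⟩
  · simpa [sub_eq_add_neg] using (hS.ends_dimer hd).2
  · intro n hn hs
    have := hS.lt_of_source_left hn (i := i) (by simpa using hs)
    omega

lemma cases_of_ends {t : ℕ} {x : ℤ} (h : ends (noisyLinks v c D t) x) :
    (2 ≤ t ∧ ∃ i, x = c i + halfWidth v t) ∨ (2 ≤ t ∧ ∃ i, x = c i - halfWidth v t) ∨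
      D t x ∨ D t (x - 1) := by
  rcases h with ⟨⟨h2, i, hi⟩ | h, hn⟩ | ⟨⟨h2, i, hi⟩ | h, hn⟩
  · refine Or.inr (Or.inl ⟨h2, i, ?_⟩)
    by_contra hne
    exact hn (Or.inl ⟨h2, i, by omega, by omega⟩)
  · exact Or.inr (Or.inr (Or.inl h))
  · refine Or.inl ⟨h2, i, ?_⟩
    by_contra hne
    exact hn (Or.inl ⟨h2, i, by omega, by omega⟩)
  · exact Or.inr (Or.inr (Or.inr h))

lemma not_noisyLinks_beside (hS : Supports v T c R D) {t : ℕ} (ht : t ≤ T) {i w : ℤ}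
    (hw : w = c i + halfWidth v t ∨ w = c i - halfWidth v t - 1) :
    ¬ noisyLinks v c D t w := by
  have hR := hS.halfWidth_le_of_le ht
  have h0 : -1 ≤ halfWidth v t := by unfold halfWidth; omega
  rintro (⟨-, j, hj⟩ | h)
  · rcases hS.sep_cases i j with rfl | h' | h' <;> omega
  · obtain ⟨j, hj⟩ := hS.mem_gap t w h
    rcases hS.sep_cases i j with rfl | h' | h' <;> omega

lemma crossed_iff (hv : 1 ≤ v) (hS : Supports v T c R D) {t : ℕ} (ht : t < T) {x : ℤ} :
    Crossed (fun τ => ends (noisyLinks v c D τ)) v t x ↔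
      (2 ≤ t ∧ ∃ i, x = c i + halfWidth v t) ∨ (2 ≤ t ∧ ∃ i, x = c i - halfWidth v t - 1) ∨
        D t x := by
  have h0 : 1 ≤ halfWidth v t := by unfold halfWidth; omega
  constructor
  · rintro (⟨h, hp⟩ | ⟨h, hp⟩)
    · rcases cases_of_ends h with h | ⟨h2, i, rfl⟩ | h | h
      · exact Or.inl h
      · exact absurd (hS.pulled_left h2 ht i) hp.not_neg
      · exact Or.inr (Or.inr h)
      · have := hS.pulled_dimer' h
        rw [sub_add_cancel] at this
        exact absurd this hp.not_neg
    · rcases cases_of_ends h with ⟨h2, i, hi⟩ | ⟨h2, i, hi⟩ | h | h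
      · rw [hi] at hp
        exact absurd hp (hS.pulled_right h2 ht i).not_neg
      · exact Or.inr (Or.inl ⟨h2, i, by omega⟩)
      · exact absurd hp (hS.pulled_dimer h).not_neg
      · exact Or.inr (Or.inr (by simpa using h))
  · rintro (⟨h2, i, rfl⟩ | ⟨h2, i, rfl⟩ | h)
    · refine Or.inl ⟨Or.inr ⟨Or.inl ⟨h2, i, by omega, by omega⟩, ?_⟩, hS.pulled_right h2 ht i⟩
      exact hS.not_noisyLinks_beside ht.le (Or.inl rfl)
    · refine Or.inr ?_
      rw [sub_add_cancel]
      refine ⟨Or.inl ⟨Or.inl ⟨h2, i, by omega, by omega⟩, ?_⟩, hS.pulled_left h2 ht i⟩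
      exact hS.not_noisyLinks_beside ht.le (Or.inr rfl)
    · exact Or.inl ⟨(hS.ends_dimer h).1, hS.pulled_dimer h⟩

lemma pulled_of_ends (hS : Supports v T c R D) {t : ℕ} (ht : t < T) {x : ℤ}
    (h : ends (noisyLinks v c D t) x) :
    Pulled (fun τ => ends (noisyLinks v c D τ)) v t 1 x ∨
      Pulled (fun τ => ends (noisyLinks v c D τ)) v t (-1) x := by
  rcases cases_of_ends h with ⟨h2, i, rfl⟩ | ⟨h2, i, rfl⟩ | h | h
  · exact Or.inl (hS.pulled_right h2 ht i)
  · exact Or.inr (hS.pulled_left h2 ht i)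
  · exact Or.inl (hS.pulled_dimer h)
  · have := hS.pulled_dimer' h
    rw [sub_add_cancel] at this
    exact Or.inr this

lemma noisyLinks_iff (hS : Supports v T c R D) (t : ℕ) (w : ℤ) :
    noisyLinks v c D t w ↔ Xor (grownLinks v c t w) (noiseLinks v c D t w) := by
  have hdisj : D t w → ¬ domains c (halfWidth v t) w := by
    rintro h ⟨j, hj⟩
    obtain ⟨i, hi⟩ := hS.mem_gap t w h
    have := hS.halfWidth_le_of_mem h
    rcases hS.sep_cases i j with rfl | h' | h' <;> omega
  unfold noisyLinks grownLinks noiseLinks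
  by_cases hd : D t w
  · simp [hd, hdisj hd, Xor]
  · by_cases hm : domains c (halfWidth v t) w
    · simp only [hd, hm, Xor]
      simp only [and_true, or_false]
      omega
    · simp [hd, hm, Xor]

lemma grownLinks_succ (hv : 1 ≤ v) (hS : Supports v T c R D) {t : ℕ} (ht : t < T) (x : ℤ) :
    grownLinks v c (t + 1) x ↔ Xor (noisyLinks v c D t x)
      (Crossed (fun τ => ends (noisyLinks v c D τ)) v t x) := by
  rw [hS.crossed_iff hv ht]
  by_cases hd : D t x
  · have h1 : noisyLinks v c D t x := Or.inr hd
    have h2 : ¬ grownLinks v c (t + 1) x := by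
      rintro ⟨-, j, hj⟩
      obtain ⟨i, hi⟩ := hS.mem_gap t x hd
      have := hS.halfWidth_le_of_mem hd
      unfold halfWidth at *
      push_cast at hj
      rcases hS.sep_cases i j with rfl | h' | h' <;> omega
    simp [h1, h2, hd]
  · by_cases hG : noisyLinks v c D t x
    · have h3 : ¬ ((2 ≤ t ∧ ∃ i, x = c i + halfWidth v t) ∨
          (2 ≤ t ∧ ∃ i, x = c i - halfWidth v t - 1) ∨ D t x) := by
        rintro (⟨-, i, hi⟩ | ⟨-, i, hi⟩ | h)
        · exact hS.not_noisyLinks_beside ht.le (Or.inl hi) hG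
        · exact hS.not_noisyLinks_beside ht.le (Or.inr hi) hG
        · exact hd h
      have h4 : grownLinks v c (t + 1) x := by
        obtain ⟨h2, i, hi⟩ := hG.resolve_right hd
        refine ⟨by omega, i, ?_⟩
        unfold halfWidth at *
        push_cast
        omega
      simp only [h3, hG, h4, Xor, not_false_eq_true, and_true, true_or]
    · simp only [hG, hd, or_false, Xor, not_false_eq_true, and_true, false_and, false_or]
      constructor
      · rintro ⟨h2, i, hi⟩
        have h5 : ¬ (c i - halfWidth v t ≤ x ∧ x < c i + halfWidth v t) := fun h =>
          hG (Or.inl ⟨by omega, i, h⟩)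
        have h6 : x = c i + halfWidth v t ∨ x = c i - halfWidth v t - 1 := by
          unfold halfWidth at *
          push_cast at hi
          omega
        rcases h6 with h6 | h6
        · exact Or.inl ⟨by omega, i, h6⟩
        · exact Or.inr ⟨by omega, i, h6⟩
      · have h0 : 1 ≤ halfWidth v t := by unfold halfWidth; omega
        rintro (⟨h2, i, hi⟩ | ⟨h2, i, hi⟩) <;>
        · refine ⟨by omega, i, ?_⟩
          unfold halfWidth at *
          push_cast
          omega

end Supports

/-! ### Closing of short gaps -/

/-- The gaps `[Y i, X i]` of the flipped links have lengths in `[1, g]`, and any two of them are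
farther apart than `g`. -/
structure ShortGaps (Y X : ℤ → ℤ) (g : ℕ) : Prop where
  lt : ∀ i, Y i < X i
  le : ∀ i, X i ≤ Y i + g
  sep : ∀ i j, i < j → X i + g < Y j

/-- How far each end of gap `i` has moved after `n` noiseless time steps: the signals from the two
ends first have to cross the gap. -/
def progress (v : ℕ) (Y X : ℤ → ℤ) (i : ℤ) (n : ℕ) : ℕ := n - ((X i - Y i).toNat - 1) / v

/-- The flipped links after `n` noiseless time steps. -/
def closedLinks (v : ℕ) (Y X : ℤ → ℤ) (n : ℕ) (w : ℤ) : Prop :=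
  ∀ i, ¬ (Y i + progress v Y X i n ≤ w ∧ w < X i - progress v Y X i n)

namespace ShortGaps

variable {v g : ℕ} {Y X : ℤ → ℤ}

lemma sep_cases (hS : ShortGaps Y X g) (i j : ℤ) :
    i = j ∨ X i + g < Y j ∨ X j + g < Y i := by
  rcases lt_trichotomy i j with h | h | h
  · exact Or.inr (Or.inl (hS.sep i j h))
  · exact Or.inl h
  · exact Or.inr (Or.inr (hS.sep j i h))

lemma ends_closedLinks (hS : ShortGaps Y X g) {n : ℕ} {x : ℤ} :
    ends (closedLinks v Y X n) x ↔
      ∃ i, Y i + progress v Y X i n < X i - progress v Y X i n ∧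
        (x = Y i + progress v Y X i n ∨ x = X i - progress v Y X i n) := by
  constructor
  · rintro (⟨h1, h2⟩ | ⟨h1, h2⟩)
    · unfold closedLinks at h2
      push Not at h2
      obtain ⟨i, hi⟩ := h2
      have := h1 i
      exact ⟨i, by omega, by omega⟩
    · unfold closedLinks at h2
      push Not at h2
      obtain ⟨i, hi⟩ := h2
      have := h1 i
      exact ⟨i, by omega, by omega⟩
  · rintro ⟨i, hlt, rfl | rfl⟩
    · refine Or.inr ⟨fun j hj => ?_, fun h => h i ⟨le_rfl, hlt⟩⟩
      have := hS.lt j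
      have := hS.lt i
      rcases hS.sep_cases i j with rfl | h | h <;> omega
    · refine Or.inl ⟨fun j hj => ?_, fun h => h i ⟨by omega, by omega⟩⟩
      have := hS.lt j
      have := hS.lt i
      rcases hS.sep_cases i j with rfl | h | h <;> omega

/-- If the distance `p k` of an emitting defect `k` time steps ago does not decrease with `k`, and if
the oldest one is within the range of its signal, then the signal of one of them arrives now: the
first `k` at which the range of the signal reaches `p k`. -/
lemma exists_arrival {p : ℕ → ℤ} {n : ℕ} (hp0 : 1 ≤ p 0)
    (hmono : ∀ k, k < n → p k ≤ p (k + 1)) (hn : p n ≤ (n + 1) * v) :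
    ∃ k ≤ n, 1 ≤ p k ∧ ((p k).toNat - 1) / v = k := by
  have hex : ∃ k : ℕ, p k ≤ (k + 1) * v := ⟨n, hn⟩
  have hle : Nat.find hex ≤ n := Nat.find_min' hex hn
  have hge : ∀ k ≤ n, 1 ≤ p k := by
    intro k
    induction k with
    | zero => intro _; exact hp0
    | succ k ih => intro hk; exact (ih (by omega)).trans (hmono k (by omega))
  refine ⟨Nat.find hex, hle, hge _ hle, ?_⟩
  have h1 := Nat.find_spec hex
  have h2 := hge _ hle
  have h3 : (Nat.find hex : ℤ) * v + 1 ≤ p (Nat.find hex) := by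
    rcases Nat.eq_zero_or_pos (Nat.find hex) with h0 | h0
    · rw [h0] at h2 ⊢
      simpa using h2
    · obtain ⟨k, hk⟩ : ∃ k, Nat.find hex = k + 1 := ⟨Nat.find hex - 1, by omega⟩
      have h4 := Nat.find_min hex (show k < Nat.find hex by omega)
      have h5 := hmono k (by omega)
      rw [hk]
      push_cast
      push Not at h4
      omega
  set k := Nat.find hex
  set q := p k
  lift q to ℕ using (by omega) with q'
  simp only [Int.toNat_natCast]
  norm_cast at h1 h2 h3
  apply Nat.div_eq_of_lt_le <;> omega

lemma progress_le_add {i : ℤ} {n k : ℕ} :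
    progress v Y X i n ≤ progress v Y X i (n - k) + k := by
  unfold progress; omega

lemma progress_mono {i : ℤ} {n k : ℕ} (h : k ≤ n) :
    progress v Y X i k ≤ progress v Y X i n := by
  unfold progress; omega

/-- The signals from the other end of a gap are closer than all other signals. -/
lemma exists_source (hv : 1 ≤ v) (hS : ShortGaps Y X g) {i : ℤ} {n : ℕ}
    (hopen : Y i + progress v Y X i n < X i - progress v Y X i n)
    (hn : ((X i - Y i).toNat - 1) / v ≤ n) :
    ∃ m : ℕ, 1 ≤ m ∧ m ≤ g ∧ (m - 1) / v ≤ n ∧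
      (Y i + progress v Y X i n + m = X i - progress v Y X i (n - (m - 1) / v)) := by
  obtain ⟨k, hk, h1, h2⟩ := exists_arrival (v := v) (n := n)
    (p := fun k => X i - progress v Y X i (n - k) - (Y i + progress v Y X i n))
    (by simp only [Nat.sub_zero]; omega)
    (by
      intro k hk
      have := progress_mono (v := v) (Y := Y) (X := X) (i := i) (show n - (k + 1) ≤ n - k by omega)
      omega)
    (by
      have h0 : (X i - Y i).toNat - 1 < (n + 1) * v :=
        (Nat.div_lt_iff_lt_mul (by omega)).mp (by omega)
      have h3 : (((X i - Y i).toNat : ℕ) : ℤ) ≤ (n + 1) * v := by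
        have : (X i - Y i).toNat ≤ (n + 1) * v := by omega
        exact_mod_cast this
      simp only [Nat.sub_self]
      omega)
  have hle := hS.le i
  refine ⟨_, ?_, ?_, h2.le.trans hk, ?_⟩
  · omega
  · omega
  · rw [h2]
    omega

lemma pulled_lower (hv : 1 ≤ v) (hS : ShortGaps Y X g) {i : ℤ} {n : ℕ}
    (hopen : Y i + progress v Y X i n < X i - progress v Y X i n)
    (hn : ((X i - Y i).toNat - 1) / v ≤ n) :
    Pulled (fun τ => ends (closedLinks v Y X τ)) v n 1 (Y i + progress v Y X i n) := by
  have hli := hS.lt i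
  obtain ⟨m, hm1, hmg, hmn, he⟩ := hS.exists_source hv hopen hn
  refine ⟨g, ⟨m, hm1, hmg, hmn, ?_⟩, ?_⟩
  · have := progress_mono (v := v) (Y := Y) (X := X) (i := i)
      (Nat.sub_le n ((m - 1) / v))
    refine hS.ends_closedLinks.mpr ⟨i, by omega, Or.inr ?_⟩
    rw [← he]
    simp
  · rintro n' hn' ⟨hk, hs⟩
    obtain ⟨j, hj, hx⟩ := hS.ends_closedLinks.mp hs
    have h1 := progress_le_add (v := v) (Y := Y) (X := X) (i := i) (n := n) (k := (n' - 1) / v)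
    have h2 := Nat.div_le_self (n' - 1) v
    have h3 := progress_mono (v := v) (Y := Y) (X := X) (i := i)
      (Nat.sub_le n ((n' - 1) / v))
    simp only [Units.val_one, one_mul] at hx
    generalize (n' - 1) / v = k at *
    rcases hS.sep_cases i j with rfl | h | h <;> omega

lemma pulled_upper (hv : 1 ≤ v) (hS : ShortGaps Y X g) {i : ℤ} {n : ℕ}
    (hopen : Y i + progress v Y X i n < X i - progress v Y X i n)
    (hn : ((X i - Y i).toNat - 1) / v ≤ n) :
    Pulled (fun τ => ends (closedLinks v Y X τ)) v n (-1) (X i - progress v Y X i n) := by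
  have hli := hS.lt i
  obtain ⟨m, hm1, hmg, hmn, he⟩ := hS.exists_source hv hopen hn
  refine ⟨g, ⟨m, hm1, hmg, hmn, ?_⟩, ?_⟩
  · have := progress_mono (v := v) (Y := Y) (X := X) (i := i)
      (Nat.sub_le n ((m - 1) / v))
    refine hS.ends_closedLinks.mpr ⟨i, by omega, Or.inl ?_⟩
    push_cast
    omega
  · rintro n' hn' ⟨hk, hs⟩
    obtain ⟨j, hj, hx⟩ := hS.ends_closedLinks.mp hs
    have h1 := progress_le_add (v := v) (Y := Y) (X := X) (i := i) (n := n) (k := (n' - 1) / v)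
    have h2 := Nat.div_le_self (n' - 1) v
    have h3 := progress_mono (v := v) (Y := Y) (X := X) (i := i)
      (Nat.sub_le n ((n' - 1) / v))
    simp only [Units.val_neg, Units.val_one, neg_mul, one_mul, sub_neg_eq_add] at hx
    generalize (n' - 1) / v = k at *
    rcases hS.sep_cases i j with rfl | h | h <;> omega

lemma quiet_of_lt (hS : ShortGaps Y X g) {i : ℤ} {n : ℕ}
    (hn : n < ((X i - Y i).toNat - 1) / v) {x : ℤ} (hx : x = Y i ∨ x = X i) :
    Quiet (fun τ => ends (closedLinks v Y X τ)) v n x := by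
  have hle := hS.le i
  have hli := hS.lt i
  rintro n' hn' ε ⟨hk, hs⟩
  obtain ⟨j, hj, hx'⟩ := hS.ends_closedLinks.mp hs
  have h1 : n' < (X i - Y i).toNat := by
    by_contra hge
    have := Nat.div_le_div_right (c := v) (show (X i - Y i).toNat - 1 ≤ n' - 1 by omega)
    omega
  have h2 : progress v Y X i (n - (n' - 1) / v) = 0 :=
    Nat.sub_eq_zero_of_le ((Nat.sub_le _ _).trans hn.le)
  rcases Int.units_eq_one_or ε with rfl | rfl <;>
  · simp only [Units.val_neg, Units.val_one, neg_mul, one_mul] at hx'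
    rcases hS.sep_cases i j with rfl | h | h
    · rw [h2] at hx'
      omega
    · omega
    · omega

lemma pulled_or_quiet (hv : 1 ≤ v) (hS : ShortGaps Y X g) {n : ℕ} {x : ℤ}
    (h : ends (closedLinks v Y X n) x) :
    Pulled (fun τ => ends (closedLinks v Y X τ)) v n 1 x ∨
      Pulled (fun τ => ends (closedLinks v Y X τ)) v n (-1) x ∨
      Quiet (fun τ => ends (closedLinks v Y X τ)) v n x := by
  obtain ⟨i, hopen, hx⟩ := hS.ends_closedLinks.mp h
  rcases le_or_gt (((X i - Y i).toNat - 1) / v) n with hn | hn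
  · rcases hx with rfl | rfl
    · exact Or.inl (hS.pulled_lower hv hopen hn)
    · exact Or.inr (Or.inl (hS.pulled_upper hv hopen hn))
  · refine Or.inr (Or.inr (hS.quiet_of_lt hn ?_))
    have : progress v Y X i n = 0 := by unfold progress; omega
    rw [this] at hx
    simpa using hx

lemma not_pulled_of_quiet {S : ℕ → ℤ → Prop} {v t : ℕ} {x : ℤ} (h : Quiet S v t x) (ε : ℤˣ) :
    ¬ Pulled S v t ε x := by
  rintro ⟨_, ⟨n, hn, -, hs⟩, -⟩
  exact h n hn ε hs

lemma crossed_iff (hv : 1 ≤ v) (hS : ShortGaps Y X g) {n : ℕ} {x : ℤ} :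
    Crossed (fun τ => ends (closedLinks v Y X τ)) v n x ↔
      ∃ i, Y i + progress v Y X i n < X i - progress v Y X i n ∧
        ((X i - Y i).toNat - 1) / v ≤ n ∧
        (x = Y i + progress v Y X i n ∨ x + 1 = X i - progress v Y X i n) := by
  constructor
  · rintro (⟨h, hp⟩ | ⟨h, hp⟩) <;> obtain ⟨i, hopen, hx⟩ := hS.ends_closedLinks.mp h
    · have hn : ((X i - Y i).toNat - 1) / v ≤ n := by
        by_contra hn
        push Not at hn
        have h0 : progress v Y X i n = 0 := by unfold progress; omega
        exact not_pulled_of_quiet (hS.quiet_of_lt hn (by rw [h0] at hx; simpa using hx)) _ hp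
      refine ⟨i, hopen, hn, ?_⟩
      rcases hx with hx | rfl
      · exact Or.inl hx
      · exact absurd (hS.pulled_upper hv hopen hn) hp.not_neg
    · have hn : ((X i - Y i).toNat - 1) / v ≤ n := by
        by_contra hn
        push Not at hn
        have h0 : progress v Y X i n = 0 := by unfold progress; omega
        exact not_pulled_of_quiet (hS.quiet_of_lt hn (by rw [h0] at hx; simpa using hx)) _ hp
      refine ⟨i, hopen, hn, ?_⟩
      rcases hx with hx | hx
      · rw [hx] at hp
        exact absurd hp (hS.pulled_lower hv hopen hn).not_neg
      · exact Or.inr hx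
  · rintro ⟨i, hopen, hn, rfl | hx⟩
    · exact Or.inl ⟨hS.ends_closedLinks.mpr ⟨i, hopen, Or.inl rfl⟩, hS.pulled_lower hv hopen hn⟩
    · refine Or.inr ?_
      rw [hx]
      exact ⟨hS.ends_closedLinks.mpr ⟨i, hopen, Or.inr rfl⟩, hS.pulled_upper hv hopen hn⟩

lemma closedLinks_succ (hv : 1 ≤ v) (hS : ShortGaps Y X g) (n : ℕ) (x : ℤ) :
    closedLinks v Y X (n + 1) x ↔ Xor (closedLinks v Y X n x)
      (Crossed (fun τ => ends (closedLinks v Y X τ)) v n x) := by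
  rw [hS.crossed_iff hv]
  have hmono := fun i => progress_mono (v := v) (Y := Y) (X := X) (i := i) (show n ≤ n + 1 by omega)
  by_cases hx : closedLinks v Y X n x
  · have h1 : closedLinks v Y X (n + 1) x := by
      intro i hi
      have := hmono i
      exact hx i ⟨by omega, by omega⟩
    have h2 : ¬ ∃ i, Y i + progress v Y X i n < X i - progress v Y X i n ∧
        ((X i - Y i).toNat - 1) / v ≤ n ∧
        (x = Y i + progress v Y X i n ∨ x + 1 = X i - progress v Y X i n) := by
      rintro ⟨i, hopen, -, h⟩
      exact hx i (by omega)
    simp only [hx, h1, h2, Xor, not_false_eq_true, and_true, true_or]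
  · simp only [hx, Xor, not_false_eq_true, and_true, false_and, false_or]
    unfold closedLinks at hx
    push Not at hx
    obtain ⟨i, hi⟩ := hx
    constructor
    · intro h
      have h1 := h i
      refine ⟨i, by omega, ?_⟩
      unfold progress at *
      omega
    · rintro ⟨j, hopen, hn, h⟩ k hk
      have hli := hS.lt i
      have hlk := hS.lt k
      have hlj := hS.lt j
      have hij : i = j := by rcases hS.sep_cases i j with h | h | h <;> omega
      have hkj : k = j := by
        rcases hS.sep_cases k j with h | h | h <;> omega
      subst hij hkj
      have : progress v Y X k (n + 1) = progress v Y X k n + 1 := by unfold progress; omega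
      omega

lemma closedLinks_of_le (hS : ShortGaps Y X g) {n : ℕ} (hn : 2 * g ≤ n) (w : ℤ) :
    closedLinks v Y X n w := by
  intro i hi
  have h1 := Nat.div_le_self ((X i - Y i).toNat - 1) v
  have h2 := hS.le i
  have h3 := hS.lt i
  unfold progress at hi
  omega

lemma closedLinks_of_not_ends (hS : ShortGaps Y X g) {n : ℕ}
    (h : ∀ x, ¬ ends (closedLinks v Y X n) x) (w : ℤ) : closedLinks v Y X n w := by
  intro i hi
  exact h _ (hS.ends_closedLinks.mpr ⟨i, by omega, Or.inl rfl⟩)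

end ShortGaps

/-! ### Random sets with uniform parameters -/

/-- The law of the random set `N ω` for a uniformly random parameter `ω`. -/
def uniformLaw {Ω α : Type} [Fintype Ω] (N : Ω → Set α) : Measure (Set α) :=
  (Fintype.card Ω : ℝ≥0∞)⁻¹ • ∑ ω, Measure.dirac (N ω)

section

variable {Ω α : Type} [Fintype Ω]

lemma uniformLaw_apply [Countable α] (N : Ω → Set α) (s : Set (Set α)) :
    uniformLaw N s =
      (Fintype.card Ω : ℝ≥0∞)⁻¹ * ((Finset.univ.filter fun ω => N ω ∈ s).card : ℝ≥0∞) := by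
  unfold uniformLaw
  rw [Measure.smul_apply, Measure.finsetSum_apply, smul_eq_mul, Finset.card_filter]
  congr 1
  push_cast
  refine Finset.sum_congr rfl fun ω _ => ?_
  rw [Measure.dirac_apply, Set.indicator_apply]
  rfl

lemma uniformLaw_eq_one [Countable α] [Nonempty Ω] {N : Ω → Set α} {s : Set (Set α)}
    (h : ∀ ω, N ω ∈ s) : uniformLaw N s = 1 := by
  rw [uniformLaw_apply, Finset.filter_true_of_mem fun ω _ => h ω, Finset.card_univ]
  exact ENNReal.inv_mul_cancel (by simp) (by simp)

lemma uniformLaw_eq_zero [Countable α] {N : Ω → Set α} {s : Set (Set α)}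
    (h : ∀ ω, N ω ∉ s) : uniformLaw N s = 0 := by
  rw [uniformLaw_apply, Finset.filter_false_of_mem fun ω _ => h ω]
  simp

lemma isProbabilityMeasure_uniformLaw [Countable α] [Nonempty Ω] (N : Ω → Set α) :
    IsProbabilityMeasure (uniformLaw N) :=
  ⟨uniformLaw_eq_one fun _ => Set.mem_univ _⟩

lemma pBounded_uniformLaw [Countable α] [Nonempty Ω] {N : Ω → Set α} {p q : ℝ} (hq : 0 ≤ q)
    (hqp : q < p)
    (h : ∀ A : Finset α, ((Finset.univ.filter fun ω => (A : Set α) ⊆ N ω).card : ℝ) ≤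
      q ^ A.card * Fintype.card Ω) : PBounded p (uniformLaw N) := by
  intro A hA
  have hcard : (0 : ℝ) < Fintype.card Ω := by exact_mod_cast Fintype.card_pos
  have h1 : uniformLaw N {N | (A : Set α) ⊆ N} =
      ENNReal.ofReal ((Fintype.card Ω : ℝ)⁻¹ *
        ((Finset.univ.filter fun ω => (A : Set α) ⊆ N ω).card : ℝ)) := by
    rw [uniformLaw_apply, ENNReal.ofReal_mul (by positivity), ENNReal.ofReal_inv_of_pos hcard,
      ENNReal.ofReal_natCast, ENNReal.ofReal_natCast]
    rfl
  rw [h1]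
  refine (ENNReal.ofReal_lt_ofReal_iff (pow_pos (hq.trans_lt hqp) _)).mpr ?_
  have h2 : (Fintype.card Ω : ℝ)⁻¹ *
      ((Finset.univ.filter fun ω => (A : Set α) ⊆ N ω).card : ℝ) ≤ q ^ A.card := by
    rw [inv_mul_le_iff₀ hcard, mul_comm]
    exact h A
  exact h2.trans_lt (pow_lt_pow_left₀ hqp hq (Finset.card_pos.mpr hA).ne')

/-- Independent blocks: the bound `P(A ⊆ N) ≤ q ^ |A|` passes to unions of independent random sets
with disjoint ranges. -/
lemma card_subset_iUnion_le {β : Type} [Fintype β] [DecidableEq β] {N : β → Ω → Set α} {q : ℝ} (hq0 : 0 ≤ q)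
    (hq1 : q ≤ 1) (hdisj : ∀ a b b' ω ω', a ∈ N b ω → a ∈ N b' ω' → b = b')
    (h : ∀ b (A : Finset α), ((Finset.univ.filter fun ω => (A : Set α) ⊆ N b ω).card : ℝ) ≤
      q ^ A.card * Fintype.card Ω) (A : Finset α) :
    ((Finset.univ.filter fun ω : β → Ω => (A : Set α) ⊆ ⋃ b, N b (ω b)).card : ℝ) ≤
      q ^ A.card * Fintype.card (β → Ω) := by
  by_cases hcov : ∀ a ∈ A, ∃ b ω, a ∈ N b ω
  · set B : β → Finset α := fun b => A.filter fun a => ∃ ω, a ∈ N b ω with hB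
    have hsub : (Finset.univ.filter fun ω : β → Ω => (A : Set α) ⊆ ⋃ b, N b (ω b)) ⊆
        Fintype.piFinset fun b => Finset.univ.filter fun ω => (B b : Set α) ⊆ N b ω := by
      intro ω hω
      rw [Finset.mem_filter] at hω
      rw [Fintype.mem_piFinset]
      intro b
      rw [Finset.mem_filter]
      refine ⟨Finset.mem_univ _, fun a ha => ?_⟩
      obtain ⟨haA, ω', hω'⟩ := Finset.mem_filter.mp (Finset.mem_coe.mp ha)
      obtain ⟨b', hb'⟩ := Set.mem_iUnion.mp (hω.2 (Finset.mem_coe.mpr haA))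
      rwa [hdisj a b b' _ _ hω' hb']
    have hA : A.card ≤ ∑ b, (B b).card := by
      refine (Finset.card_le_card ?_).trans Finset.card_biUnion_le
      intro a ha
      obtain ⟨b, ω, hω⟩ := hcov a ha
      exact Finset.mem_biUnion.mpr ⟨b, Finset.mem_univ _, Finset.mem_filter.mpr ⟨ha, ω, hω⟩⟩
    calc ((Finset.univ.filter fun ω : β → Ω => (A : Set α) ⊆ ⋃ b, N b (ω b)).card : ℝ)
        ≤ ((Fintype.piFinset fun b =>
            Finset.univ.filter fun ω => (B b : Set α) ⊆ N b ω).card : ℝ) := by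
          exact_mod_cast Finset.card_le_card hsub
      _ = ∏ b, ((Finset.univ.filter fun ω => (B b : Set α) ⊆ N b ω).card : ℝ) := by
          rw [Fintype.card_piFinset]
          push_cast
          rfl
      _ ≤ ∏ b, q ^ (B b).card * (Fintype.card Ω : ℝ) :=
          Finset.prod_le_prod (fun _ _ => by positivity) fun b _ => h b (B b)
      _ = q ^ (∑ b, (B b).card) * Fintype.card (β → Ω) := by
          rw [Finset.prod_mul_distrib, Finset.prod_pow_eq_pow_sum, Fintype.card_fun]
          simp
      _ ≤ q ^ A.card * Fintype.card (β → Ω) := by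
          gcongr ?_ * _
          exact pow_le_pow_of_le_one hq0 hq1 hA
  · push Not at hcov
    obtain ⟨a, ha, hn⟩ := hcov
    rw [Finset.filter_false_of_mem]
    · simp only [Finset.card_empty, Nat.cast_zero]
      positivity
    · intro ω _ hω
      obtain ⟨b, hb⟩ := Set.mem_iUnion.mp (hω (Finset.mem_coe.mpr ha))
      exact hn b _ hb

end

/-! ### Sets with one uniformly placed element for each index -/

section

variable {ι α : Type} [Fintype ι] [DecidableEq ι] [DecidableEq α] {R : ι → ℕ}

/-- For independent choices `r i` among `R i` places each, and if all places are distinct, the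
choices that cover `A` are fixed on as many indices as they have to cover elements. -/
lemma exists_card_covering_le {loc : (Σ i, Fin (R i)) → α} (hinj : Function.Injective loc)
    (I A : Finset α) :
    (Finset.univ.filter fun r : ∀ i, Fin (R i) => ∀ a ∈ A, a ∈ I ∨ ∃ i, loc ⟨i, r i⟩ = a).card = 0 ∨
    ∃ J : Finset ι, (A \ I).card ≤ J.card ∧ (∀ i ∈ J, ∃ x, loc ⟨i, x⟩ ∈ A) ∧
      (Finset.univ.filter fun r : ∀ i, Fin (R i) =>
        ∀ a ∈ A, a ∈ I ∨ ∃ i, loc ⟨i, r i⟩ = a).card ≤ ∏ i, if i ∈ J then 1 else R i := by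
  rw [or_iff_not_imp_left]
  intro hne
  obtain ⟨r₀, hr₀⟩ := Finset.card_pos.mp (Nat.pos_of_ne_zero hne)
  replace hr₀ := (Finset.mem_filter.mp hr₀).2
  have hr₀' : ∀ a : (A \ I : Finset α), ∃ i, loc ⟨i, r₀ i⟩ = a := fun a =>
    (hr₀ a (Finset.mem_sdiff.mp a.2).1).resolve_left (Finset.mem_sdiff.mp a.2).2
  choose f hf using hr₀'
  have hfinj : Function.Injective f := by
    intro a b hab
    apply Subtype.ext
    rw [← hf a, ← hf b, hab]
  refine ⟨Finset.univ.image f, ?_, ?_, ?_⟩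
  · rw [Finset.card_image_of_injective _ hfinj, Finset.card_univ, Fintype.card_coe]
  · intro i hi
    obtain ⟨a, -, rfl⟩ := Finset.mem_image.mp hi
    refine ⟨r₀ (f a), ?_⟩
    rw [hf a]
    exact (Finset.mem_sdiff.mp a.2).1
  · have hsub : (Finset.univ.filter fun r : ∀ i, Fin (R i) =>
        ∀ a ∈ A, a ∈ I ∨ ∃ i, loc ⟨i, r i⟩ = a) ⊆
        Fintype.piFinset fun i => if i ∈ Finset.univ.image f then {r₀ i} else Finset.univ := by
      intro r hr
      replace hr := (Finset.mem_filter.mp hr).2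
      rw [Fintype.mem_piFinset]
      intro i
      split_ifs with hi
      · obtain ⟨a, -, rfl⟩ := Finset.mem_image.mp hi
        obtain ⟨j, hj⟩ := (hr a (Finset.mem_sdiff.mp a.2).1).resolve_left
          (Finset.mem_sdiff.mp a.2).2
        have h1 := hinj (hj.trans (hf a).symm)
        rw [Finset.mem_singleton]
        obtain ⟨h2, h3⟩ := Sigma.mk.inj h1
        subst h2
        exact eq_of_heq h3
      · exact Finset.mem_univ _
    refine (Finset.card_le_card hsub).trans (le_of_eq ?_)
    rw [Fintype.card_piFinset]
    refine Finset.prod_congr rfl fun i _ => ?_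
    split_ifs <;> simp

variable {m : ℕ}

lemma card_covering_mul_pow_le (hm : 1 ≤ m) (hR : ∀ i, R i ≤ m)
    {loc : (Σ i, Fin (R i)) → α} (hinj : Function.Injective loc) (I A : Finset α) :
    (Finset.univ.filter fun r : ∀ i, Fin (R i) =>
      ∀ a ∈ A, a ∈ I ∨ ∃ i, loc ⟨i, r i⟩ = a).card * m ^ A.card ≤
      m ^ (I.card + Fintype.card ι) := by
  rcases exists_card_covering_le hinj I A with h | ⟨J, hJ, -, h⟩
  · rw [h, zero_mul]
    exact Nat.zero_le _
  · have hA : A.card ≤ I.card + J.card := by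
      have := Finset.card_le_card_sdiff_add_card (s := A) (t := I)
      omega
    calc _ ≤ (∏ i, if i ∈ J then 1 else R i) * m ^ (I.card + J.card) :=
          Nat.mul_le_mul h (Nat.pow_le_pow_right hm hA)
      _ = m ^ I.card * ∏ i, ((if i ∈ J then 1 else R i) * if i ∈ J then m else 1) := by
          rw [Finset.prod_mul_distrib, Finset.prod_ite_mem, Finset.univ_inter, Finset.prod_const,
            pow_add]
          ring
      _ ≤ m ^ I.card * ∏ _i : ι, m := by
          gcongr with i
          split_ifs <;> simp [hR i]
      _ = _ := by
          rw [Finset.prod_const, Finset.card_univ, pow_add]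

lemma card_covering_mul_pow_le_prod {loc : (Σ i, Fin (R i)) → α} (hinj : Function.Injective loc)
    (hm : 1 ≤ m) (I A : Finset α) (hI : ∀ a ∈ A, a ∉ I)
    (hlate : ∀ i x, loc ⟨i, x⟩ ∈ A → R i = m) :
    (Finset.univ.filter fun r : ∀ i, Fin (R i) =>
      ∀ a ∈ A, a ∈ I ∨ ∃ i, loc ⟨i, r i⟩ = a).card * m ^ A.card ≤ ∏ i, R i := by
  rcases exists_card_covering_le hinj I A with h | ⟨J, hJ, hJA, h⟩
  · rw [h, zero_mul]
    exact Nat.zero_le _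
  · rw [Finset.sdiff_eq_self_of_disjoint (Finset.disjoint_left.mpr hI)] at hJ
    calc _ ≤ (∏ i, if i ∈ J then 1 else R i) * m ^ J.card :=
          Nat.mul_le_mul h (Nat.pow_le_pow_right hm hJ)
      _ = ∏ i, ((if i ∈ J then 1 else R i) * if i ∈ J then m else 1) := by
          rw [Finset.prod_mul_distrib, Finset.prod_ite_mem, Finset.univ_inter, Finset.prod_const]
      _ = _ := by
          refine Finset.prod_congr rfl fun i _ => ?_
          split_ifs with hi
          · obtain ⟨x, hx⟩ := hJA i hi
            rw [one_mul, hlate i x hx]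
          · rw [mul_one]

/-- A random set consisting of a fixed pattern `I z` around a random centre `z ∈ Fin M` and of one
element for each index `i`, placed uniformly among `R i ≤ m` places that depend on `z`. Covering a
given element by the fixed pattern or with fewer than `m` choices pins `z` down to `W` values; if
`M` is so large that this outweighs all missing choices together, then the random set covers `A`
with probability at most `(2 / m) ^ |A|`. -/
lemma card_random_pattern_le {M W : ℕ} (hm : 1 ≤ m) (hR : ∀ i, R i ≤ m)
    {loc : Fin M → (Σ i, Fin (R i)) → α} (hinj : ∀ z, Function.Injective (loc z))
    (I : Fin M → Finset α) {h₀ : ℕ} (hI : ∀ z, (I z).card ≤ h₀)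
    (hearly : ∀ a, (Finset.univ.filter fun z =>
      a ∈ I z ∨ ∃ i x, loc z ⟨i, x⟩ = a ∧ R i ≠ m).card ≤ W)
    (hM : W * m ^ (h₀ + Fintype.card ι) ≤ M * ∏ i, R i) (A : Finset α) :
    ((Finset.univ.filter fun ω : Fin M × (∀ i, Fin (R i)) =>
      ∀ a ∈ A, a ∈ I ω.1 ∨ ∃ i, loc ω.1 ⟨i, ω.2 i⟩ = a).card : ℝ) ≤
      (2 / m) ^ A.card * Fintype.card (Fin M × (∀ i, Fin (R i))) := by
  set E : Finset (Fin M) := A.biUnion fun a => Finset.univ.filter fun z =>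
    a ∈ I z ∨ ∃ i x, loc z ⟨i, x⟩ = a ∧ R i ≠ m with hE
  have hEcard : E.card ≤ A.card * W :=
    Finset.card_biUnion_le_card_mul _ _ _ fun a _ => hearly a
  have hnat : (Finset.univ.filter fun ω : Fin M × (∀ i, Fin (R i)) =>
      ∀ a ∈ A, a ∈ I ω.1 ∨ ∃ i, loc ω.1 ⟨i, ω.2 i⟩ = a).card * m ^ A.card ≤
      2 ^ A.card * (M * ∏ i, R i) := by
    calc _ = ∑ z : Fin M, (Finset.univ.filter fun r : ∀ i, Fin (R i) =>
            ∀ a ∈ A, a ∈ I z ∨ ∃ i, loc z ⟨i, r i⟩ = a).card * m ^ A.card := by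
          rw [← Finset.sum_mul]
          congr 1
          simp only [Finset.card_filter]
          rw [Fintype.sum_prod_type]
      _ ≤ ∑ z : Fin M, (∏ i, R i + if z ∈ E then m ^ (h₀ + Fintype.card ι) else 0) := by
          refine Finset.sum_le_sum fun z _ => ?_
          split_ifs with hz
          · refine (card_covering_mul_pow_le hm hR (hinj z) (I z) A).trans ?_
            refine (Nat.pow_le_pow_right hm (Nat.add_le_add_right (hI z) _)).trans ?_
            exact Nat.le_add_left _ _
          · rw [add_zero]
            refine card_covering_mul_pow_le_prod (hinj z) hm (I z) A (fun a ha haI => ?_)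
              (fun i x hx => ?_)
            · exact hz (Finset.mem_biUnion.mpr ⟨a, ha, by simp [haI]⟩)
            · by_contra hne
              exact hz (Finset.mem_biUnion.mpr ⟨_, hx, Finset.mem_filter.mpr
                ⟨Finset.mem_univ _, Or.inr ⟨i, x, rfl, hne⟩⟩⟩)
      _ = M * ∏ i, R i + E.card * m ^ (h₀ + Fintype.card ι) := by
          rw [Finset.sum_add_distrib, Finset.sum_ite_mem]
          simp
      _ ≤ M * ∏ i, R i + A.card * (M * ∏ i, R i) := by
          have : E.card * m ^ (h₀ + Fintype.card ι) ≤
              A.card * W * m ^ (h₀ + Fintype.card ι) := Nat.mul_le_mul_right _ hEcard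
          have := Nat.mul_le_mul_left A.card hM
          rw [← mul_assoc] at this
          omega
      _ = (A.card + 1) * (M * ∏ i, R i) := by ring
      _ ≤ 2 ^ A.card * (M * ∏ i, R i) := Nat.mul_le_mul_right _ (Nat.lt_two_pow_self)
  have hcard : Fintype.card (Fin M × (∀ i, Fin (R i))) = M * ∏ i, R i := by
    simp [Fintype.card_prod, Fintype.card_pi]
  rw [hcard, div_pow, div_mul_eq_mul_div, le_div_iff₀ (by positivity)]
  exact_mod_cast hnat

end

/-! ### The noise -/

/-- The number of places among which the dimer is chosen that supports an end of a domain `s` time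
steps after the creation of the domain: as many as can be used, but at most `m`. -/
def choices (v m s : ℕ) : ℕ := min m (s / (2 * v) + 1)

/-- The link of the dimer number `ρ` that supports the right (`true`) or left (`false`) end of the
domain with centre `c` in time step `s + 2`. -/
def dimerLink (v : ℕ) (c : ℤ) (s ρ : ℕ) : Bool → ℤ
  | true => c + halfWidth v (s + 2) + 1 + (2 * ρ + 2) * v
  | false => c - halfWidth v (s + 2) - 2 - (2 * ρ + 2) * v

/-- The line of length `L` is divided into `k` blocks of almost equal lengths, each with a domain
that grows for `n` time steps around a centre chosen among `M` sites, supported by dimers with at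
most `m` choices each. The bound `M_ge` makes the noise cheap enough, and by `n_ge` the domains
become longer than the gaps between them. -/
structure Layout (v L : ℕ) where
  m : ℕ
  n : ℕ
  M : ℕ
  k : ℕ
  v_pos : 1 ≤ v
  m_pos : 1 ≤ m
  k_pos : 1 ≤ k
  M_ge : 37 * v * m * m ^ (4 * v + 2) * 3 ^ (4 * v * m) ≤ M
  n_ge : 4 * m * v + 20 + 2 * M ≤ n
  length_ge : k * (2 * (2 * v + n + 2 * m * v + 11) + M) ≤ L
  length_le : L ≤ k * (2 * (2 * v + n + 2 * m * v + 11) + M + 1)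

namespace Layout

variable {v L : ℕ} (P : Layout v L)

/-- A bound on the distance of all noise of a block from its centre. -/
def reach : ℕ := 2 * v + n P + 2 * P.m * v + 11

/-- The random parameters of a block: the position of its centre, and the choices of the dimers that
support the two ends of its domain in the different time steps. -/
abbrev Param : Type := Fin P.M × (∀ i : Bool × Fin P.n, Fin (choices v P.m i.2))

/-- The left end of block `i`. -/
def base (i : ℤ) : ℤ := i * L / P.k

/-- The centre of block `i`. -/
def centre (ω : ZMod P.k → P.Param) (i : ℤ) : ℤ := P.base i + P.reach + (ω i).1

/-- The dimers of a block with centre `c` in time step `t`. -/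
def blockDimers (c : ℤ) (r : ∀ i : Bool × Fin P.n, Fin (choices v P.m i.2)) (t : ℕ) (w : ℤ) :
    Prop :=
  ∃ i : Bool × Fin P.n, t = i.2 - 2 * (r i : ℕ) ∧ w = dimerLink v c i.2 (r i) i.1

/-- The dimers of all blocks in time step `t`. -/
def dimers (ω : ZMod P.k → P.Param) (t : ℕ) (w : ℤ) : Prop :=
  ∃ i : ℤ, P.blockDimers (P.centre ω i) (ω i).2 t w

variable {P}

lemma two_mul_choice_le {s ρ : ℕ} (h : ρ < choices v P.m s) :
    2 * ρ * v ≤ s ∧ 2 * ρ ≤ s ∧ ρ + 1 ≤ P.m := by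
  have hv := P.v_pos
  have h1 : ρ < s / (2 * v) + 1 := lt_of_lt_of_le h (min_le_right _ _)
  have h2 : ρ < P.m := lt_of_lt_of_le h (min_le_left _ _)
  have h3 : ρ * (2 * v) ≤ s := (Nat.le_div_iff_mul_le (by omega)).mp (by omega)
  have h4 : 2 * ρ * v ≤ s := by linarith
  exact ⟨h4, by nlinarith, by omega⟩

/-- The position of a dimer in terms of the half-width at the time when it is created. -/
lemma dimerLink_true {c : ℤ} {s ρ : ℕ} (hs : s < P.n) (hρ : ρ < choices v P.m s) :
    dimerLink v c s ρ true = c + halfWidth v (s - 2 * ρ) + 1 + (2 * ρ + 2) * (v + 1) ∧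
      dimerLink v c s ρ true ≤ c + P.reach - 5 := by
  obtain ⟨h1, h2, h3⟩ := two_mul_choice_le (P := P) hρ
  have h4 : (ρ + 1) * v ≤ P.m * v := Nat.mul_le_mul_right v h3
  zify at h4
  have h6 : (P.reach : ℤ) = 2 * v + P.n + 2 * (P.m * v) + 11 := by
    unfold reach; push_cast; ring
  have h7 : (s : ℤ) + 1 ≤ P.n := by exact_mod_cast hs
  unfold dimerLink halfWidth
  push_cast [Nat.cast_sub h2]
  rw [h6]
  constructor
  · ring
  · linarith

lemma dimerLink_false {c : ℤ} {s ρ : ℕ} (hs : s < P.n) (hρ : ρ < choices v P.m s) :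
    dimerLink v c s ρ false = c - halfWidth v (s - 2 * ρ) - 2 - (2 * ρ + 2) * (v + 1) ∧
      c - P.reach + 5 ≤ dimerLink v c s ρ false := by
  obtain ⟨h1, h2, h3⟩ := two_mul_choice_le (P := P) hρ
  have h4 : (ρ + 1) * v ≤ P.m * v := Nat.mul_le_mul_right v h3
  zify at h4
  have h6 : (P.reach : ℤ) = 2 * v + P.n + 2 * (P.m * v) + 11 := by
    unfold reach; push_cast; ring
  have h7 : (s : ℤ) + 1 ≤ P.n := by exact_mod_cast hs
  unfold dimerLink halfWidth
  push_cast [Nat.cast_sub h2]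
  rw [h6]
  constructor
  · ring
  · linarith

lemma blockDimers_cases {c : ℤ} {r : ∀ i : Bool × Fin P.n, Fin (choices v P.m i.2)} {t : ℕ} {w : ℤ}
    (h : P.blockDimers c r t w) : ∃ ρ : ℕ,
      (w = c + halfWidth v t + 1 + (2 * ρ + 2) * (v + 1) ∧ w ≤ c + P.reach - 5) ∨
      (w = c - halfWidth v t - 2 - (2 * ρ + 2) * (v + 1) ∧ c - P.reach + 5 ≤ w) := by
  obtain ⟨⟨b, s⟩, rfl, rfl⟩ := h
  refine ⟨r (b, s), ?_⟩
  cases b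
  · exact Or.inr (dimerLink_false s.2 (r (false, s)).2)
  · exact Or.inl (dimerLink_true s.2 (r (true, s)).2)

lemma base_sep (i j : ℤ) (h : i < j) : P.base i + 2 * P.reach + P.M ≤ P.base j := by
  have hk : (0 : ℤ) < P.k := by exact_mod_cast P.k_pos
  have h1 := P.length_ge
  zify at h1
  have h2 : (2 * P.reach + P.M : ℤ) = (2 * (2 * v + P.n + 2 * P.m * v + 11) + P.M : ℤ) := by
    unfold reach; push_cast; ring
  unfold base
  rw [add_assoc, h2, ← Int.add_mul_ediv_right _ _ hk.ne']
  refine Int.ediv_le_ediv hk ?_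
  have h3 : (0 : ℤ) ≤ L := by positivity
  nlinarith

lemma base_succ_le (i : ℤ) : P.base (i + 1) ≤ P.base i + 2 * P.reach + P.M + 1 := by
  have hk : (0 : ℤ) < P.k := by exact_mod_cast P.k_pos
  have h1 := P.length_le
  zify at h1
  have h2 : (2 * P.reach + P.M + 1 : ℤ) = (2 * (2 * v + P.n + 2 * P.m * v + 11) + P.M + 1 : ℤ) := by
    unfold reach; push_cast; ring
  unfold base
  have h3 : i * L / P.k + 2 * P.reach + P.M + 1 = i * L / P.k + (2 * P.reach + P.M + 1 : ℤ) := by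
    ring
  rw [h3, h2, ← Int.add_mul_ediv_right _ _ hk.ne']
  refine Int.ediv_le_ediv hk ?_
  linarith

lemma base_add_mul (i q : ℤ) : P.base (i + q * P.k) = P.base i + q * L := by
  have hk : (0 : ℤ) < P.k := by exact_mod_cast P.k_pos
  unfold base
  rw [← Int.add_mul_ediv_right _ _ hk.ne']
  congr 1
  ring

lemma centre_add_mul (ω : ZMod P.k → P.Param) (i q : ℤ) :
    P.centre ω (i + q * P.k) = P.centre ω i + q * L := by
  unfold centre
  rw [base_add_mul]
  have : ((i + q * P.k : ℤ) : ZMod P.k) = i := by simp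
  rw [this]
  ring

lemma supports (ω : ZMod P.k → P.Param) :
    Supports v (P.n + 2) (P.centre ω) P.reach (P.dimers ω) := by
  have hv := P.v_pos
  have hmv : 1 ≤ P.m * v := Nat.mul_pos P.m_pos P.v_pos
  have hreach : (P.reach : ℤ) = 2 * v + P.n + 2 * (P.m * v) + 11 := by
    unfold reach; push_cast; ring
  have hsep : ∀ i j, i < j → P.centre ω i + 2 * P.reach ≤ P.centre ω j := by
    intro i j h
    have h1 := P.base_sep i j h
    have h2 := (ω i).1.2
    unfold centre
    omega
  have hrange : ∀ {c : ℤ} {r : ∀ i : Bool × Fin P.n, Fin (choices v P.m i.2)} {t : ℕ} {w : ℤ},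
      P.blockDimers c r t w →
        (c + halfWidth v t + 5 ≤ w ∧ w ≤ c + P.reach - 5) ∨
        (c - P.reach + 5 ≤ w ∧ w ≤ c - halfWidth v t - 6) := by
    intro c r t w h
    obtain ⟨ρ, ⟨h1, h2⟩ | ⟨h1, h2⟩⟩ := blockDimers_cases h
    · refine Or.inl ⟨?_, h2⟩
      have : (4 : ℤ) ≤ (2 * ρ + 2) * (v + 1) := by
        have : (4 : ℕ) ≤ (2 * ρ + 2) * (v + 1) := by nlinarith
        exact_mod_cast this
      omega
    · refine Or.inr ⟨h2, ?_⟩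
      have : (4 : ℤ) ≤ (2 * ρ + 2) * (v + 1) := by
        have : (4 : ℕ) ≤ (2 * ρ + 2) * (v + 1) := by nlinarith
        exact_mod_cast this
      omega
  have hstep : ∀ ρ ρ' : ℕ, ρ < ρ' → (0 : ℤ) ≤ (2 * ρ + 2) * (v + 1) ∧
      ((2 * ρ + 2) * (v + 1) : ℤ) + 4 ≤ (2 * ρ' + 2) * (v + 1) := by
    intro ρ ρ' h
    have : (2 * ρ + 2) * (v + 1) + 4 ≤ (2 * ρ' + 2) * (v + 1) := by nlinarith
    exact ⟨by positivity, by exact_mod_cast this⟩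
  refine ⟨hsep, ?_, ?_, ?_, ?_, ?_⟩
  · unfold halfWidth
    push_cast
    rw [hreach]
    have : (0 : ℤ) ≤ P.m * v := by positivity
    linarith
  · rintro t w ⟨i, hi⟩
    exact ⟨i, hrange hi⟩
  · rintro t w w' ⟨i, hi⟩ ⟨j, hj⟩ hlt
    have h1 := hrange hi
    have h2 := hrange hj
    have h3 : 1 ≤ halfWidth v t := by unfold halfWidth; omega
    rcases lt_trichotomy i j with h | rfl | h
    · have := hsep i j h
      omega
    · obtain ⟨ρ, hρ⟩ := blockDimers_cases hi
      obtain ⟨ρ', hρ'⟩ := blockDimers_cases hj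
      rcases lt_trichotomy ρ ρ' with h | rfl | h
      · have := hstep _ _ h
        omega
      · omega
      · have := hstep _ _ h
        omega
    · have := hsep j i h
      omega
  all_goals
    intro t h2 ht i
    obtain ⟨s, rfl⟩ : ∃ s, t = s + 2 := ⟨t - 2, by omega⟩
  · set ρ := (ω i).2 (true, ⟨s, by omega⟩) with hρ
    obtain ⟨h3, h4, -⟩ := two_mul_choice_le (P := P) ρ.2
    simp only at h3 h4
    have hdiv : ((2 * (ρ : ℕ) + 2) * v + 1 - 1) / v = 2 * ρ + 2 := by
      rw [Nat.add_sub_cancel, Nat.mul_div_cancel _ (by omega)]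
    have h5 : (2 * (ρ : ℕ) + 2) * v = 2 * ρ * v + 2 * v := by ring
    refine ⟨(2 * ρ + 2) * v + 1, by omega, ?_, by omega, i, (true, ⟨s, by omega⟩), ?_, ?_⟩
    · rw [h5]
      unfold halfWidth
      push_cast
      zify at h3
      linarith
    · rw [hdiv]
      simp only [← hρ]
      omega
    · simp only [dimerLink, ← hρ]
      push_cast
      ring
  · set ρ := (ω i).2 (false, ⟨s, by omega⟩) with hρ
    obtain ⟨h3, h4, -⟩ := two_mul_choice_le (P := P) ρ.2
    simp only at h3 h4
    have hdiv : ((2 * (ρ : ℕ) + 2) * v + 1 - 1) / v = 2 * ρ + 2 := by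
      rw [Nat.add_sub_cancel, Nat.mul_div_cancel _ (by omega)]
    have h5 : (2 * (ρ : ℕ) + 2) * v = 2 * ρ * v + 2 * v := by ring
    refine ⟨(2 * ρ + 2) * v + 1, by omega, ?_, by omega, i, (false, ⟨s, by omega⟩), ?_, ?_⟩
    · rw [h5]
      unfold halfWidth
      push_cast
      zify at h3
      linarith
    · rw [hdiv]
      simp only [← hρ]
      omega
    · simp only [dimerLink, ← hρ]
      push_cast
      ring

/-! ### Periodicity -/

lemma periodic_of_shift {F : ℤ → Prop} (h : ∀ (q w : ℤ), F w → F (w + q * L)) : Periodic L F := by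
  intro x y hxy
  obtain ⟨q, hq⟩ := (ZMod.intCast_eq_intCast_iff_dvd_sub x y L).mp hxy
  have h1 := h q x
  have h2 := h (-q) y
  constructor
  · intro hx
    have e : y = x + q * L := by linarith
    rw [e]
    exact h1 hx
  · intro hy
    have e : x = y + -q * L := by linarith
    rw [e]
    exact h2 hy

lemma periodic_domains (ω : ZMod P.k → P.Param) (h : ℤ) : Periodic L (domains (P.centre ω) h) := by
  refine periodic_of_shift fun q w => ?_
  rintro ⟨i, hi⟩
  refine ⟨i + q * P.k, ?_⟩
  rw [centre_add_mul]
  omega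

lemma dimerLink_add (c x : ℤ) (s ρ : ℕ) (b : Bool) :
    dimerLink v (c + x) s ρ b = dimerLink v c s ρ b + x := by
  cases b <;> simp only [dimerLink] <;> ring

lemma periodic_dimers (ω : ZMod P.k → P.Param) (t : ℕ) : Periodic L (P.dimers ω t) := by
  refine periodic_of_shift fun q w => ?_
  rintro ⟨i, j, hj, hw⟩
  have e : ((i + q * P.k : ℤ) : ZMod P.k) = i := by simp
  refine ⟨i + q * P.k, ?_⟩
  rw [centre_add_mul, e]
  exact ⟨j, hj, by rw [dimerLink_add, hw]⟩

lemma periodic_grownLinks (ω : ZMod P.k → P.Param) (t : ℕ) :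
    Periodic L (grownLinks v (P.centre ω) t) := by
  intro x y h
  unfold grownLinks
  rw [periodic_domains ω _ x y h]

lemma periodic_noiseLinks (ω : ZMod P.k → P.Param) (t : ℕ) :
    Periodic L (noiseLinks v (P.centre ω) (P.dimers ω) t) := by
  intro x y h
  unfold noiseLinks
  rw [periodic_domains ω _ x y h, periodic_dimers ω _ x y h]

end Layout

/-! ### Counting the choices -/

lemma pow_self_le_three_pow_mul_factorial (m : ℕ) : m ^ m ≤ 3 ^ m * m.factorial := by
  have h1 := Real.pow_div_factorial_le_exp (m : ℝ) (by positivity) m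
  rw [div_le_iff₀ (by positivity)] at h1
  have h2 : Real.exp (m : ℝ) ≤ 3 ^ m := by
    rw [← mul_one (m : ℝ), Real.exp_nat_mul]
    exact pow_le_pow_left₀ (Real.exp_pos _).le Real.exp_one_lt_three.le _
  have h3 : (m : ℝ) ^ m ≤ 3 ^ m * m.factorial :=
    h1.trans (mul_le_mul_of_nonneg_right h2 (by positivity))
  exact_mod_cast h3

lemma prod_choices {v m : ℕ} (hv : 1 ≤ v) (a : ℕ) (ha : a ≤ m) :
    ∏ s ∈ Finset.range (2 * v * a), choices v m s = a.factorial ^ (2 * v) := by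
  induction a with
  | zero => simp
  | succ a ih =>
    rw [Nat.mul_succ, Finset.prod_range_add, ih (by omega), Nat.factorial_succ, mul_pow, mul_comm]
    congr 1
    rw [Finset.prod_congr rfl (g := fun _ => a + 1), Finset.prod_const, Finset.card_range]
    intro j hj
    rw [Finset.mem_range] at hj
    unfold choices
    rw [Nat.mul_add_div (by omega), Nat.div_eq_of_lt hj, add_zero]
    exact min_eq_right ha

/-- The missing choices of all dimers of one side together amount to a factor exponential in `m`,
since the number of choices grows linearly with time: `m ^ m / m! ≤ 3 ^ m`. -/
lemma pow_le_prod_choices {v m : ℕ} (hv : 1 ≤ v) (hm : 1 ≤ m) (n : ℕ) :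
    m ^ n ≤ 3 ^ (2 * v * m) * ∏ s ∈ Finset.range n, choices v m s := by
  have h0 : m ^ (2 * v * m) ≤
      3 ^ (2 * v * m) * ∏ s ∈ Finset.range (2 * v * m), choices v m s := by
    rw [prod_choices hv m le_rfl]
    have := Nat.pow_le_pow_left (pow_self_le_three_pow_mul_factorial m) (2 * v)
    rwa [mul_pow, ← pow_mul, ← pow_mul, mul_comm m] at this
  rcases le_total (2 * v * m) n with h | h
  · induction n, h using Nat.le_induction with
    | base => exact h0
    | succ n hn ih =>
      have : choices v m n = m := by
        refine min_eq_left ?_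
        have := (Nat.le_div_iff_mul_le (show 0 < 2 * v by omega)).mpr
          (show m * (2 * v) ≤ n by linarith)
        omega
      rw [Finset.prod_range_succ, this, pow_succ, ← mul_assoc]
      exact Nat.mul_le_mul_right m ih
  · obtain ⟨e, he⟩ := Nat.exists_eq_add_of_le h
    have descend : ∀ e, m ^ (n + e) ≤
        3 ^ (2 * v * m) * ∏ s ∈ Finset.range (n + e), choices v m s →
        m ^ n ≤ 3 ^ (2 * v * m) * ∏ s ∈ Finset.range n, choices v m s := by
      intro e
      induction e with
      | zero => exact id
      | succ e ih =>
        intro h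
        have h1 : choices v m (n + e) ≤ m := min_le_left _ _
        rw [← add_assoc, Finset.prod_range_succ, pow_succ, ← mul_assoc] at h
        exact ih (Nat.le_of_mul_le_mul_right (h.trans (Nat.mul_le_mul_left _ h1)) hm)
    refine descend e ?_
    rw [← he]
    convert h0 using 3

lemma eq_of_linePt_eq {d L : ℕ} [NeZero d] {x y : ℤ} (h : linePt d L x = linePt d L y)
    (h1 : x - y < L) (h2 : y - x < L) : x = y := by
  have h3 := (ZMod.intCast_eq_intCast_iff_dvd_sub x y L).mp (linePt_inj.mp h)
  have := Int.eq_zero_of_abs_lt_dvd h3 (abs_lt.mpr ⟨by omega, by omega⟩)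
  omega

namespace Layout

variable {v L : ℕ}

instance (P : Layout v L) : NeZero P.k := ⟨by have := P.k_pos; omega⟩

lemma two_mul_reach_lt (P : Layout v L) : 2 * P.reach + P.M ≤ L := by
  have h1 := P.length_ge
  have h2 := P.k_pos
  unfold reach
  exact (Nat.le_mul_of_pos_left _ h2).trans h1

lemma M_pos (P : Layout v L) : 1 ≤ P.M := by
  have h1 := P.v_pos
  have h2 := P.m_pos
  refine le_trans ?_ P.M_ge
  exact Nat.one_le_iff_ne_zero.mpr (by positivity)

lemma choices_pos (P : Layout v L) (s : ℕ) : 0 < choices v P.m s :=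
  lt_min P.m_pos (Nat.succ_pos _)

instance (P : Layout v L) : Nonempty P.Param :=
  ⟨⟨0, P.M_pos⟩, fun i => ⟨0, P.choices_pos i.2⟩⟩

/-- The noise of block `b` with parameters `θ`, delayed by `τ` time steps. In time step `2` the
domain is created; apart from this there are only dimers. -/
def blockNoise (d : ℕ) [NeZero d] (P : Layout v L) (τ : ℕ) (b : ZMod P.k) (θ : P.Param) :
    Set (Loc d L) :=
  {u | ∃ (i : ℤ) (t : ℕ) (w : ℤ), (i : ZMod P.k) = b ∧ u = (Sum.inl (linePt d L w, 0), t + τ) ∧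
    ((t = 2 ∧ P.base i + P.reach + θ.1 - halfWidth v t ≤ w ∧
        w < P.base i + P.reach + θ.1 + halfWidth v t) ∨
      P.blockDimers (P.base i + P.reach + θ.1) θ.2 t w)}

/-- The noise of all blocks, delayed by `τ` time steps. -/
def noise (d : ℕ) [NeZero d] (P : Layout v L) (τ : ℕ) (ω : ZMod P.k → P.Param) : Set (Loc d L) :=
  ⋃ b, P.blockNoise d τ b (ω b)

variable {d : ℕ} [NeZero d] {P : Layout v L}

lemma mem_noise {τ : ℕ} {ω : ZMod P.k → P.Param} {u : Loc d L} :
    u ∈ P.noise d τ ω ↔ ∃ (t : ℕ) (w : ℤ), u = (Sum.inl (linePt d L w, 0), t + τ) ∧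
      noiseLinks v (P.centre ω) (P.dimers ω) t w := by
  unfold noise noiseLinks domains dimers
  rw [Set.mem_iUnion]
  constructor
  · rintro ⟨b, i, t, w, rfl, rfl, ⟨h2, h⟩ | h⟩
    · exact ⟨t, w, rfl, Or.inl ⟨h2, i, h⟩⟩
    · exact ⟨t, w, rfl, Or.inr ⟨i, h⟩⟩
  · rintro ⟨t, w, rfl, ⟨h2, i, h⟩ | ⟨i, h⟩⟩
    · exact ⟨i, i, t, w, rfl, rfl, Or.inl ⟨h2, h⟩⟩
    · exact ⟨i, i, t, w, rfl, rfl, Or.inr h⟩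

/-- The noise of block `i` lies inside of the block. -/
lemma blockNoise_range {i : ℤ} {t : ℕ} {w : ℤ} {θ : P.Param}
    (h : (t = 2 ∧ P.base i + P.reach + θ.1 - halfWidth v t ≤ w ∧
        w < P.base i + P.reach + θ.1 + halfWidth v t) ∨
      P.blockDimers (P.base i + P.reach + θ.1) θ.2 t w) :
    P.base i ≤ w ∧ w < P.base i + 2 * P.reach + P.M := by
  have hz := θ.1.2
  have hr : 2 * v + P.n + 2 * P.m * v + 11 = P.reach := rfl
  have hv := P.v_pos
  rcases h with ⟨rfl, h⟩ | h
  · unfold halfWidth at h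
    push_cast at h
    generalize P.reach = r at *
    generalize 2 * P.m * v = a at *
    omega
  · have h0 : 1 ≤ halfWidth v t := by unfold halfWidth; omega
    obtain ⟨ρ, h | h⟩ := blockDimers_cases h
    · have : (0 : ℤ) ≤ (2 * ρ + 2) * (v + 1) := by positivity
      omega
    · have : (0 : ℤ) ≤ (2 * ρ + 2) * (v + 1) := by positivity
      omega

/-- The blocks are disjoint on the periodic line. -/
lemma block_unique {i i' w w' : ℤ} (hw : P.base i ≤ w ∧ w < P.base i + 2 * P.reach + P.M)
    (hw' : P.base i' ≤ w' ∧ w' < P.base i' + 2 * P.reach + P.M)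
    (h : linePt d L w = linePt d L w') : (i : ZMod P.k) = (i' : ZMod P.k) := by
  obtain ⟨q, hq⟩ := (ZMod.intCast_eq_intCast_iff_dvd_sub _ _ L).mp (linePt_inj.mp h)
  have h3 := P.base_add_mul i q
  have hii : i + q * P.k = i' := by
    rcases lt_trichotomy (i + q * P.k) i' with h | h | h
    · have := P.base_sep _ _ h
      linarith
    · exact h
    · have := P.base_sep _ _ h
      linarith
  rw [← hii]
  simp

lemma blockNoise_disjoint {τ : ℕ} {b b' : ZMod P.k} {θ θ' : P.Param} {u : Loc d L}
    (h : u ∈ P.blockNoise d τ b θ) (h' : u ∈ P.blockNoise d τ b' θ') : b = b' := by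
  obtain ⟨i, t, w, rfl, rfl, hw⟩ := h
  obtain ⟨i', t', w', rfl, hu, hw'⟩ := h'
  rw [Prod.mk.injEq, Sum.inl.injEq, Prod.mk.injEq] at hu
  exact block_unique (blockNoise_range hw) (blockNoise_range hw') hu.1.1

variable (P) in
/-- The location of the dimer `ρ` for index `i` in a block with centre `c`. -/
def dimerLoc (d : ℕ) [NeZero d] (τ : ℕ) (c : ℤ)
    (x : Σ i : Bool × Fin P.n, Fin (choices v P.m i.2)) : Loc d L :=
  (Sum.inl (linePt d L (dimerLink v c x.1.2 x.2 x.1.1), 0), x.1.2 - 2 * (x.2 : ℕ) + τ)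

lemma dimerLoc_injective (τ : ℕ) (c : ℤ) : Function.Injective (P.dimerLoc d τ c) := by
  have hv := P.v_pos
  rintro ⟨⟨b, s⟩, ρ⟩ ⟨⟨b', s'⟩, ρ'⟩ h
  have hL := P.two_mul_reach_lt
  have hinj : ∀ a a' : ℕ, (2 * a + 2) * (v + 1 : ℤ) = (2 * a' + 2) * (v + 1) → a = a' := by
    intro a a' h
    have h1 : (v + 1 : ℤ) ≠ 0 := by positivity
    have := mul_right_cancel₀ h1 h
    omega
  have hnn : ∀ a : ℕ, (0 : ℤ) ≤ (2 * a + 2) * (v + 1) := fun a => by positivity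
  unfold dimerLoc at h
  simp only [Prod.mk.injEq, Sum.inl.injEq] at h
  obtain ⟨⟨h1, -⟩, ht⟩ := h
  have ht' : (s : ℕ) - 2 * (ρ : ℕ) = s' - 2 * (ρ' : ℕ) := by omega
  obtain ⟨-, h3, -⟩ := two_mul_choice_le (P := P) ρ.2
  obtain ⟨-, h3', -⟩ := two_mul_choice_le (P := P) ρ'.2
  have hH : ∀ t, 1 ≤ halfWidth v t := by intro t; unfold halfWidth; omega
  have h0 := hH (s - 2 * ρ)
  have h0' := hH (s' - 2 * ρ')
  have e1 := hnn ρ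
  have e2 := hnn ρ'
  have key : b = b' ∧ (ρ : ℕ) = ρ' := by
    cases b <;> cases b'
    · have a1 := dimerLink_false (P := P) (c := c) s.2 ρ.2
      have a2 := dimerLink_false (P := P) (c := c) s'.2 ρ'.2
      have := eq_of_linePt_eq h1 (by omega) (by omega)
      refine ⟨rfl, hinj _ _ ?_⟩
      rw [a1.1, a2.1, ht'] at this
      linarith
    · have a1 := dimerLink_false (P := P) (c := c) s.2 ρ.2
      have a2 := dimerLink_true (P := P) (c := c) s'.2 ρ'.2
      have := eq_of_linePt_eq h1 (by omega) (by omega)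
      omega
    · have a1 := dimerLink_true (P := P) (c := c) s.2 ρ.2
      have a2 := dimerLink_false (P := P) (c := c) s'.2 ρ'.2
      have := eq_of_linePt_eq h1 (by omega) (by omega)
      omega
    · have a1 := dimerLink_true (P := P) (c := c) s.2 ρ.2
      have a2 := dimerLink_true (P := P) (c := c) s'.2 ρ'.2
      have := eq_of_linePt_eq h1 (by omega) (by omega)
      refine ⟨rfl, hinj _ _ ?_⟩
      rw [a1.1, a2.1, ht'] at this
      linarith
  obtain ⟨rfl, hρ⟩ := key
  have hs : s = s' := Fin.ext (by simp only at h3 h3'; omega)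
  subst hs
  have : ρ = ρ' := Fin.ext hρ
  rw [this]

/-- The locations of the noise that creates a domain with centre `c`. -/
def seed (d v L : ℕ) [NeZero d] (τ : ℕ) (c : ℤ) : Finset (Loc d L) :=
  (Finset.Ico (c - halfWidth v 2) (c + halfWidth v 2)).image fun w =>
    (Sum.inl (linePt d L w, 0), 2 + τ)

lemma card_seed_le (τ : ℕ) (c : ℤ) : (seed d v L τ c).card ≤ 4 * v + 2 := by
  refine Finset.card_image_le.trans ?_
  rw [Int.card_Ico]
  unfold halfWidth
  omega

/-- Noise with fewer than `m` choices is close to the centre, which it thus pins down. -/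
lemma card_early_le (τ : ℕ) (c : ℤ) (u : Loc d L) :
    (Finset.univ.filter fun z : Fin P.M => u ∈ seed d v L τ (c + z) ∨
      ∃ i x, P.dimerLoc d τ (c + z) ⟨i, x⟩ = u ∧ choices v P.m i.2 ≠ P.m).card ≤
      37 * v * P.m := by
  have hv := P.v_pos
  have hm := P.m_pos
  have hmv : v ≤ P.m * v := Nat.le_mul_of_pos_left _ hm
  set B : ℕ := 9 * (P.m * v) with hB
  have hclose : ∀ z : Fin P.M, (u ∈ seed d v L τ (c + z) ∨
      ∃ i x, P.dimerLoc d τ (c + z) ⟨i, x⟩ = u ∧ choices v P.m i.2 ≠ P.m) →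
      ∃ (w : ℤ) (t : ℕ), u = (Sum.inl (linePt d L w, 0), t) ∧ c + z - B ≤ w ∧ w ≤ c + z + B ∧
        c + z - P.reach ≤ w ∧ w ≤ c + z + P.reach := by
    rintro z (h | ⟨⟨b, s⟩, ρ, rfl, hne⟩)
    · obtain ⟨w, hw, rfl⟩ := Finset.mem_image.mp h
      rw [Finset.mem_Ico] at hw
      refine ⟨w, _, rfl, ?_⟩
      have hr : (P.reach : ℤ) = 2 * v + P.n + 2 * P.m * v + 11 := by unfold reach; push_cast; ring
      have : (0 : ℤ) ≤ 2 * P.m * v := by positivity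
      unfold halfWidth at hw
      push_cast at hw
      omega
    · refine ⟨_, _, rfl, ?_⟩
      obtain ⟨-, -, h3⟩ := two_mul_choice_le (P := P) ρ.2
      have h4 : ((ρ : ℕ) + 1) * v ≤ P.m * v := Nat.mul_le_mul_right v h3
      have h5 : (s : ℕ) < P.m * (2 * v) := by
        by_contra hge
        apply hne
        have := (Nat.le_div_iff_mul_le (show 0 < 2 * v by omega)).mpr (not_lt.mp hge)
        exact min_eq_left (this.trans (Nat.le_succ _))
      have h6 : ((s : ℕ) : ℤ) < 2 * (P.m * v) := by
        have : P.m * (2 * v) = 2 * (P.m * v) := by ring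
        rw [this] at h5
        exact_mod_cast h5
      have h7 : (((ρ : ℕ) : ℤ) + 1) * v ≤ P.m * v := by exact_mod_cast h4
      have h8 : (2 * ((ρ : ℕ) : ℤ) + 2) * v = 2 * ((((ρ : ℕ) : ℤ) + 1) * v) := by ring
      have h9 : (0 : ℤ) ≤ (((ρ : ℕ) : ℤ) + 1) * v := by positivity
      have h10 : ((s : ℕ) : ℤ) + 1 ≤ P.n := by exact_mod_cast s.2
      have hr : (P.reach : ℤ) = 2 * v + P.n + 2 * (P.m * v) + 11 := by
        unfold reach; push_cast; ring
      have hB' : (B : ℤ) = 9 * (P.m * v) := by rw [hB]; push_cast; ring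
      have hmv' : (v : ℤ) ≤ P.m * v := by exact_mod_cast hmv
      cases b <;>
      · simp only [dimerLink, halfWidth]
        push_cast
        rw [hr, hB', h8]
        refine ⟨?_, ?_, ?_, ?_⟩ <;> linarith
  by_cases hex : ∃ z₀ : Fin P.M, u ∈ seed d v L τ (c + z₀) ∨
      ∃ i x, P.dimerLoc d τ (c + z₀) ⟨i, x⟩ = u ∧ choices v P.m i.2 ≠ P.m
  · obtain ⟨z₀, hz₀⟩ := hex
    obtain ⟨w₀, t₀, hu₀, hw₀⟩ := hclose z₀ hz₀
    have hL := P.two_mul_reach_lt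
    have hinjz : Function.Injective fun z : Fin P.M => ((z : ℕ) : ℤ) := fun a b h =>
      Fin.ext (Int.ofNat.inj h)
    rw [← Finset.card_image_of_injective _ hinjz]
    have hsub : (Finset.univ.filter fun z : Fin P.M => u ∈ seed d v L τ (c + z) ∨
        ∃ i x, P.dimerLoc d τ (c + z) ⟨i, x⟩ = u ∧ choices v P.m i.2 ≠ P.m).image
        (fun z : Fin P.M => ((z : ℕ) : ℤ)) ⊆ Finset.Icc ((z₀ : ℕ) - 2 * B : ℤ) (z₀ + 2 * B) := by
      intro y hy
      obtain ⟨z, hz, rfl⟩ := Finset.mem_image.mp hy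
      obtain ⟨w, t, hu, hw⟩ := hclose z (Finset.mem_filter.mp hz).2
      rw [hu, Prod.mk.injEq, Sum.inl.injEq, Prod.mk.injEq] at hu₀
      have hzM := z.2
      have hzM₀ := z₀.2
      have : w = w₀ := eq_of_linePt_eq hu₀.1.1 (by omega) (by omega)
      rw [Finset.mem_Icc]
      omega
    refine (Finset.card_le_card hsub).trans ?_
    rw [Int.card_Icc]
    have : 37 * v * P.m = 37 * (P.m * v) := by ring
    rw [this]
    omega
  · push Not at hex
    rw [Finset.filter_false_of_mem]
    · simp
    · rintro z - (h | ⟨i, x, h1, h2⟩)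
      · exact (hex z).1 h
      · exact h2 ((hex z).2 i x h1)

variable (P) in
/-- The number of sites for the centre outweighs all missing choices. -/
lemma mul_pow_le_mul_prod_choices :
    37 * v * P.m * P.m ^ (4 * v + 2 + Fintype.card (Bool × Fin P.n)) ≤
      P.M * ∏ i : Bool × Fin P.n, choices v P.m i.2 := by
  have h1 := pow_le_prod_choices P.v_pos P.m_pos P.n
  have h3 : ∏ i : Bool × Fin P.n, choices v P.m i.2 =
      (∏ s ∈ Finset.range P.n, choices v P.m s) * ∏ s ∈ Finset.range P.n, choices v P.m s := by
    rw [Fintype.prod_prod_type, Fintype.prod_bool,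
      Fin.prod_univ_eq_prod_range (fun s => choices v P.m s)]
  have h4 : Fintype.card (Bool × Fin P.n) = P.n + P.n := by simp; ring
  have h5 : 3 ^ (4 * v * P.m) = 3 ^ (2 * v * P.m) * 3 ^ (2 * v * P.m) := by
    rw [← pow_add]; congr 1; ring
  have h6 := P.M_ge
  rw [h5] at h6
  rw [h3, h4, pow_add _ _ (P.n + P.n), pow_add _ P.n, ← mul_assoc]
  generalize 3 ^ (2 * v * P.m) = a at *
  generalize ∏ s ∈ Finset.range P.n, choices v P.m s = b at *
  generalize 37 * v * P.m * P.m ^ (4 * v + 2) = e at *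
  calc e * (P.m ^ P.n * P.m ^ P.n) ≤ e * ((a * b) * (a * b)) :=
        Nat.mul_le_mul_left _ (Nat.mul_le_mul h1 h1)
    _ = e * (a * a) * (b * b) := by ring
    _ ≤ P.M * (b * b) := Nat.mul_le_mul_right _ h6

/-- By periodicity, the noise of block `b` is the one of the block number `b.val`. -/
lemma mem_seed_or_dimerLoc {τ : ℕ} {b : ZMod P.k} {θ : P.Param} {u : Loc d L}
    (hu : u ∈ P.blockNoise d τ b θ) :
    u ∈ seed d v L τ (P.base b.val + P.reach + (θ.1 : ℕ)) ∨
      ∃ i, P.dimerLoc d τ (P.base b.val + P.reach + (θ.1 : ℕ)) ⟨i, θ.2 i⟩ = u := by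
  obtain ⟨i, t, w, hi, rfl, h⟩ := hu
  have hcast : ((b.val : ℤ) : ZMod P.k) = (i : ZMod P.k) := by
    rw [hi, Int.cast_natCast, ZMod.natCast_zmod_val]
  obtain ⟨q, hq⟩ := (ZMod.intCast_eq_intCast_iff_dvd_sub _ _ P.k).mp hcast
  have hbase : P.base i = P.base b.val + q * L := by
    rw [← base_add_mul]
    congr 1
    linarith
  have hpt : linePt d L w = linePt d L (w - q * L) := linePt_inj.mpr (by simp)
  rw [hbase] at h
  rcases h with ⟨rfl, h⟩ | ⟨j, hj, hw⟩
  · refine Or.inl (Finset.mem_image.mpr ⟨w - q * L, ?_, by rw [hpt]⟩)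
    rw [Finset.mem_Ico]
    constructor <;> linarith
  · refine Or.inr ⟨j, ?_⟩
    have e : P.base b.val + q * L + P.reach + (θ.1 : ℕ) =
        P.base b.val + P.reach + (θ.1 : ℕ) + q * L := by ring
    rw [e, dimerLink_add] at hw
    unfold dimerLoc
    rw [hpt, hw, hj, add_sub_cancel_right]

lemma card_subset_blockNoise_le (τ : ℕ) (b : ZMod P.k) (A : Finset (Loc d L)) :
    ((Finset.univ.filter fun θ : P.Param => (A : Set (Loc d L)) ⊆ P.blockNoise d τ b θ).card : ℝ) ≤
      (2 / P.m) ^ A.card * Fintype.card P.Param := by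
  refine le_trans ?_ (card_random_pattern_le (α := Loc d L) (R := fun i : Bool × Fin P.n =>
      choices v P.m i.2) P.m_pos (fun i => min_le_left _ _)
    (loc := fun z => P.dimerLoc d τ (P.base b.val + P.reach + (z : ℕ)))
    (fun z => dimerLoc_injective τ _)
    (fun z => seed d v L τ (P.base b.val + P.reach + (z : ℕ)))
    (h₀ := 4 * v + 2) (fun z => card_seed_le τ _) (W := 37 * v * P.m)
    (fun u => ?_) P.mul_pow_le_mul_prod_choices A)
  swap
  · convert card_early_le (P := P) τ (P.base b.val + P.reach) u
  refine Nat.cast_le.mpr (Finset.card_le_card fun θ hθ => ?_)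
  rw [Finset.mem_filter] at hθ ⊢
  exact ⟨Finset.mem_univ _, fun a ha => mem_seed_or_dimerLoc (hθ.2 (Finset.mem_coe.mpr ha))⟩

lemma pBounded_noise [NeZero L] {p : ℝ} (hp : 2 / (P.m : ℝ) < p) (hp1 : p ≤ 1) (τ : ℕ) :
    PBounded p (uniformLaw (P.noise d τ)) := by
  have h0 : (0 : ℝ) ≤ 2 / P.m := by positivity
  refine pBounded_uniformLaw h0 hp fun A => ?_
  have h := card_subset_iUnion_le (N := P.blockNoise d τ) h0 (hp.le.trans hp1)
    (fun _ _ _ _ _ => blockNoise_disjoint) (card_subset_blockNoise_le τ) A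
  exact h

end Layout

/-! ### The logical error -/

section

variable {d L : ℕ} [NeZero d]

lemma lineChain_false : lineChain d L (fun _ => False) = 0 := by
  funext ℓ
  exact if_neg fun ⟨_, w, _, h⟩ => h

lemma syndrome_lineChain_eq_zero {F : ℤ → Prop} (hF : Periodic L F) :
    syndrome (lineChain d L F) = 0 ↔ ∀ x, ¬ ends F x := by
  rw [syndrome_lineChain hF]
  constructor
  · intro h x hx
    have h1 := (lineSyndrome_linePt (d := d) hF.ends x).mpr hx
    rw [h] at h1
    exact zero_ne_one h1
  · intro h
    funext x
    exact if_neg fun ⟨w, _, hw⟩ => h w hw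

lemma winding_lineChain_true [NeZero L] :
    winding (lineChain d L (fun _ => True)) = Pi.single 0 1 := by
  funext a
  unfold winding
  by_cases ha : a = 0
  · subst ha
    rw [Pi.single_eq_same, Finset.sum_eq_single (linePt d L 0)]
    · have hp : Periodic L (fun _ => True) := fun _ _ _ => Iff.rfl
      rw [lineChain_linePt hp]
      simp [linePt]
    · intro x _ hx
      by_cases h0 : x 0 = 0
      · rw [if_pos h0]
        refine if_neg fun ⟨_, w, hw, _⟩ => hx ?_
        simp only at hw
        rw [hw] at h0 ⊢
        unfold linePt at h0 ⊢
        rw [Pi.single_eq_same] at h0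
        rw [h0, Int.cast_zero]
      · rw [if_neg h0]
    · simp
  · rw [Pi.single_eq_of_ne ha]
    refine Finset.sum_eq_zero fun x _ => ?_
    split_ifs
    · exact if_neg fun h => ha h.1
    · rfl

end

namespace Layout

variable {v L : ℕ} {P : Layout v L} {d : ℕ} [NeZero d]

/-- During the noise, the domains grow by one site on each side in each time step. -/
lemma err_evolve_noise (tie : TieBreak d) (hL : (P.n + 2) * v < L) (ω : ZMod P.k → P.Param) :
    (evolve v tie (P.noise d 0 ω) (P.n + 2)).err =
      lineChain d L (grownLinks v (P.centre ω) (P.n + 2)) := by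
  have hS := P.supports ω
  have hnoise : ∀ (t : ℕ) (ℓ : Link d L), (Sum.inl ℓ, t) ∈ P.noise d 0 ω ↔
      (ℓ.2 = 0 ∧ ∃ w, ℓ.1 = linePt d L w ∧ noiseLinks v (P.centre ω) (P.dimers ω) t w) := by
    rintro t ⟨x, a⟩
    rw [mem_noise]
    constructor
    · rintro ⟨t', w, h, hw⟩
      simp only [Prod.mk.injEq, Sum.inl.injEq, add_zero] at h
      obtain ⟨⟨rfl, rfl⟩, rfl⟩ := h
      exact ⟨rfl, w, rfl, hw⟩
    · rintro ⟨h1, w, h2, hw⟩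
      simp only at h1 h2
      subst h1 h2
      exact ⟨t, w, rfl, hw⟩
  have hmeas : ∀ (t : ℕ) (x : Site d L), (Sum.inr x, t) ∉ P.noise d 0 ω := by
    intro t x h
    rw [mem_noise] at h
    obtain ⟨t', w, h, -⟩ := h
    simp at h
  refine err_eq_lineChain (T := P.n + 2) P.v_pos hL tie (F := grownLinks v (P.centre ω))
    (Q := noiseLinks v (P.centre ω) (P.dimers ω)) (G := noisyLinks v (P.centre ω) (P.dimers ω))
    (periodic_grownLinks ω) (periodic_noiseLinks ω) hS.noisyLinks_iff
    (s := evolve v tie (P.noise d 0 ω)) ?_ ?_ ?_ ?_ _ le_rfl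
  · have : grownLinks v (P.centre ω) 0 = fun _ => False := by
      funext w
      simp [grownLinks]
    rw [this, lineChain_false]
    rfl
  · intro t _
    rw [evolve]
    congr 1
    · funext ℓ
      unfold lineChain
      simp only [hnoise]
    · funext x
      exact if_neg (hmeas t x)
  · intro t ht x hx
    exact (hS.pulled_of_ends ht hx).imp_right Or.inl
  · intro t ht x
    exact hS.grownLinks_succ P.v_pos ht x

variable (P) in
/-- A bound on the lengths of the gaps between the domains at the end of the noise. -/
def gapBound : ℕ := 4 * P.m * v + 20 + 2 * P.M

/-- The lower end of the gap between domains `i` and `i + 1` at the end of the noise. -/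
def gapLower (ω : ZMod P.k → P.Param) (i : ℤ) : ℤ := P.centre ω i + halfWidth v (P.n + 2)

/-- The upper end of the gap between domains `i` and `i + 1` at the end of the noise. -/
def gapUpper (ω : ZMod P.k → P.Param) (i : ℤ) : ℤ := P.centre ω (i + 1) - halfWidth v (P.n + 2)

lemma shortGaps (ω : ZMod P.k → P.Param) :
    ShortGaps (gapLower ω) (gapUpper ω) P.gapBound := by
  have hS := P.supports ω
  have hsep := hS.sep
  have hle := hS.halfWidth_le
  have hg : (P.gapBound : ℤ) = 4 * (P.m * v) + 20 + 2 * P.M := by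
    unfold gapBound; push_cast; ring
  have hr : (P.reach : ℤ) = 2 * v + P.n + 2 * (P.m * v) + 11 := by unfold reach; push_cast; ring
  have hn : 4 * ((P.m : ℤ) * v) + 20 + 2 * P.M ≤ P.n := by
    have := P.n_ge
    zify at this
    linarith
  have hH : halfWidth v (P.n + 2) = 2 * v + P.n + 1 := by unfold halfWidth; push_cast; ring
  refine ⟨fun i => ?_, fun i => ?_, fun i j hij => ?_⟩
  · have := hsep i (i + 1) (by omega)
    unfold gapLower gapUpper
    omega
  · have h1 := P.base_succ_le i
    have h2 := (ω i).1.2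
    have h3 := (ω (i + 1 : ℤ)).1.2
    unfold gapLower gapUpper centre
    omega
  · have h1 : P.centre ω (i + 1) ≤ P.centre ω j := by
      rcases eq_or_lt_of_le (show i + 1 ≤ j by omega) with h | h
      · rw [h]
      · have := hsep _ _ h
        omega
    unfold gapLower gapUpper
    omega

lemma exists_centre_le (ω : ZMod P.k → P.Param) (w : ℤ) :
    ∃ i, P.centre ω i ≤ w ∧ w < P.centre ω (i + 1) := by
  have hsep := (P.supports ω).sep
  have hr : 1 ≤ (P.reach : ℤ) := by unfold reach; omega
  have hup : ∀ j : ℕ, P.centre ω 0 + j ≤ P.centre ω j := by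
    intro j
    induction j with
    | zero => simp
    | succ j ih =>
      have := hsep j (j + 1) (by omega)
      push_cast
      omega
  have hdown : ∀ j : ℕ, P.centre ω (-j) ≤ P.centre ω 0 - j := by
    intro j
    induction j with
    | zero => simp
    | succ j ih =>
      have := hsep (-((j + 1 : ℕ) : ℤ)) (-j) (by omega)
      omega
  have hex : ∃ i, P.centre ω i ≤ w := by
    refine ⟨-((P.centre ω 0 - w).toNat : ℤ), ?_⟩
    have := hdown (P.centre ω 0 - w).toNat
    omega
  have hbdd : ∃ b : ℤ, ∀ i, P.centre ω i ≤ w → i ≤ b := by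
    refine ⟨(w - P.centre ω 0).toNat, fun i hi => ?_⟩
    by_contra hlt
    push Not at hlt
    have h1 := hup (w - P.centre ω 0).toNat
    have h2 := hsep _ _ hlt
    omega
  obtain ⟨i, hi, hmax⟩ := Int.exists_greatest_of_bdd hbdd hex
  refine ⟨i, hi, ?_⟩
  by_contra hlt
  have := hmax (i + 1) (not_lt.mp hlt)
  omega

/-- At the end of the noise, the links outside of the gaps are flipped. -/
lemma closedLinks_zero (ω : ZMod P.k → P.Param) :
    closedLinks v (gapLower ω) (gapUpper ω) 0 = grownLinks v (P.centre ω) (P.n + 2) := by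
  have hS := P.supports ω
  have hle := hS.halfWidth_le
  have h0 : 1 ≤ halfWidth v (P.n + 2) := by
    have := P.v_pos
    unfold halfWidth; omega
  have hn := P.n_ge
  funext w
  apply propext
  unfold closedLinks progress gapLower gapUpper grownLinks domains
  simp only [Nat.zero_sub, Nat.cast_zero, add_zero, sub_zero]
  constructor
  · intro h
    obtain ⟨i, h1, h2⟩ := exists_centre_le ω w
    have h3 := h i
    refine ⟨by omega, ?_⟩
    by_cases h4 : w < P.centre ω i + halfWidth v (P.n + 2)
    · exact ⟨i, by omega, h4⟩
    · exact ⟨i + 1, by omega, by omega⟩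
  · rintro ⟨-, j, hj⟩ i hi
    rcases hS.sep_cases i j with rfl | h | h
    · omega
    · rcases hS.sep_cases (i + 1) j with rfl | h' | h'
      · omega
      · omega
      · have := hS.sep i (i + 1) (by omega)
        have hij : i < j := by
          by_contra hge
          rcases eq_or_lt_of_le (not_lt.mp hge) with rfl | h5
          · omega
          · have := hS.sep _ _ h5
            omega
        rcases eq_or_lt_of_le (show i + 1 ≤ j by omega) with rfl | h5
        · omega
        · have := hS.sep _ _ h5
          omega
    · omega

lemma periodic_closedLinks (ω : ZMod P.k → P.Param) (n : ℕ) :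
    Periodic L (closedLinks v (gapLower ω) (gapUpper ω) n) := by
  have key : ∀ (q w : ℤ), closedLinks v (gapLower ω) (gapUpper ω) n w →
      closedLinks v (gapLower ω) (gapUpper ω) n (w + q * L) := by
    intro q w h i hi
    have h1 : gapLower ω (i + -q * P.k) = gapLower ω i + -q * L := by
      unfold gapLower
      rw [centre_add_mul]
      ring
    have h2 : gapUpper ω (i + -q * P.k) = gapUpper ω i + -q * L := by
      unfold gapUpper
      rw [add_right_comm, centre_add_mul]
      ring
    have h3 : progress v (gapLower ω) (gapUpper ω) (i + -q * P.k) n =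
        progress v (gapLower ω) (gapUpper ω) i n := by
      unfold progress
      rw [h1, h2]
      congr 4
      ring
    refine h (i + -q * P.k) ?_
    rw [h1, h2, h3]
    constructor <;> linarith [hi.1, hi.2]
  exact periodic_of_shift key

lemma err_noiselessRun (tie : TieBreak d) (hL : 2 * P.gapBound * v < L) (ω : ZMod P.k → P.Param)
    {n : ℕ} (hn : n ≤ 2 * P.gapBound) :
    (noiselessRun v tie (lineChain d L (grownLinks v (P.centre ω) (P.n + 2))) n).err =
      lineChain d L (closedLinks v (gapLower ω) (gapUpper ω) n) := by
  have hS := P.shortGaps ω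
  rw [← closedLinks_zero]
  refine err_eq_lineChain (T := 2 * P.gapBound) P.v_pos hL tie
    (F := closedLinks v (gapLower ω) (gapUpper ω)) (Q := fun _ _ => False)
    (G := closedLinks v (gapLower ω) (gapUpper ω)) (periodic_closedLinks ω)
    (fun _ _ _ _ => Iff.rfl) (fun t x => by simp [Xor])
    (s := noiselessRun v tie (lineChain d L (closedLinks v (gapLower ω) (gapUpper ω) 0)))
    rfl ?_ ?_ ?_ n hn
  · intro t _
    rw [lineChain_false]
    exact Function.iterate_succ_apply' _ _ _
  · intro t _ x hx
    exact hS.pulled_or_quiet P.v_pos hx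
  · intro t _ x
    exact hS.closedLinks_succ P.v_pos t x

variable [NeZero L]

lemma residualClass_messagePassing (tie : TieBreak d) (hL : 2 * P.gapBound * v < L)
    (ω : ZMod P.k → P.Param) :
    residualClass v tie (lineChain d L (grownLinks v (P.centre ω) (P.n + 2)))
      Offline.messagePassing = Pi.single 0 1 := by
  have hS := P.shortGaps ω
  set e := lineChain d L (grownLinks v (P.centre ω) (P.n + 2)) with he
  have hend : syndrome (noiselessRun v tie e (2 * P.gapBound)).err = 0 := by
    rw [err_noiselessRun tie hL ω le_rfl, syndrome_lineChain_eq_zero (periodic_closedLinks ω _)]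
    intro x hx
    have := fun w => hS.closedLinks_of_le (v := v) (n := 2 * P.gapBound) le_rfl w
    simp [ends, this, Xor] at hx
  have hex : ∃ n, syndrome (noiselessRun v tie e n).err = 0 := ⟨_, hend⟩
  unfold residualClass
  simp only
  rw [dif_pos hex]
  have hspec := Nat.find_spec hex
  have hle : Nat.find hex ≤ 2 * P.gapBound := Nat.find_min' hex hend
  rw [err_noiselessRun tie hL ω hle] at hspec ⊢
  rw [syndrome_lineChain_eq_zero (periodic_closedLinks ω _)] at hspec
  have : closedLinks v (gapLower ω) (gapUpper ω) (Nat.find hex) = fun _ => True := by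
    funext w
    exact eq_true (hS.closedLinks_of_not_ends hspec w)
  rw [this, winding_lineChain_true]

/-- The domains cover more than half of the line. -/
lemma lt_two_mul_card_flipped (ω : ZMod P.k → P.Param) :
    L < 2 * (Finset.univ.filter fun ℓ : Link d L =>
      lineChain d L (grownLinks v (P.centre ω) (P.n + 2)) ℓ = 1).card := by
  have hS := P.supports ω
  have hle := hS.halfWidth_le
  have hH : halfWidth v (P.n + 2) = 2 * v + P.n + 1 := by unfold halfWidth; push_cast; ring
  set H : ℕ := 2 * v + P.n + 1 with hHdef
  have hHH : halfWidth v (P.n + 2) = H := by rw [hH, hHdef]; push_cast; ring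
  have hn := P.n_ge
  set f : ZMod P.k × Fin (2 * H) → Link d L := fun x =>
    (linePt d L (P.centre ω x.1.val - H + (x.2 : ℕ)), 0) with hf
  have hrange : ∀ x : ZMod P.k × Fin (2 * H),
      P.base x.1.val ≤ P.centre ω x.1.val - H + (x.2 : ℕ) ∧
      P.centre ω x.1.val - H + (x.2 : ℕ) < P.base x.1.val + 2 * P.reach + P.M := by
    intro x
    have h1 := (ω ((x.1.val : ℤ) : ZMod P.k)).1.2
    have h2 := x.2.2
    unfold centre
    omega
  have hinj : Function.Injective f := by
    intro x y hxy
    simp only [hf, Prod.mk.injEq, and_true] at hxy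
    have h1 := block_unique (P := P) (hrange x) (hrange y) hxy
    simp only [Int.cast_natCast, ZMod.natCast_zmod_val] at h1
    rw [← h1] at hxy
    have hL := P.two_mul_reach_lt
    have h2 := x.2.2
    have h3 := y.2.2
    have h4 := eq_of_linePt_eq hxy (by omega) (by omega)
    exact Prod.ext h1 (Fin.ext (by omega))
  have hcard : P.k * (2 * H) ≤ (Finset.univ.filter fun ℓ : Link d L =>
      lineChain d L (grownLinks v (P.centre ω) (P.n + 2)) ℓ = 1).card := by
    have h1 : (Finset.univ.image f).card = P.k * (2 * H) := by
      rw [Finset.card_image_of_injective _ hinj, Finset.card_univ, Fintype.card_prod, ZMod.card,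
        Fintype.card_fin]
    rw [← h1]
    refine Finset.card_le_card fun ℓ hℓ => ?_
    obtain ⟨x, -, rfl⟩ := Finset.mem_image.mp hℓ
    rw [Finset.mem_filter]
    refine ⟨Finset.mem_univ _, ?_⟩
    rw [hf, lineChain_linePt (periodic_grownLinks ω _), if_pos]
    have h2 := x.2.2
    exact ⟨by omega, x.1.val, by omega, by omega⟩
  have h1 := P.length_le
  have h2 : P.k * (2 * (2 * v + P.n + 2 * P.m * v + 11) + P.M + 1) < P.k * (2 * (2 * H)) := by
    refine Nat.mul_lt_mul_of_pos_left ?_ P.k_pos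
    rw [hHdef]
    have h3 : 4 * P.m * v = 2 * (2 * P.m * v) := by ring
    omega
  have h3 : P.k * (2 * (2 * H)) = 2 * (P.k * (2 * H)) := by ring
  omega

lemma residualClass_noise (tie : TieBreak d) (hL : (P.n + 2) * v < L)
    (hL' : 2 * P.gapBound * v < L) (K : Offline) (hK : K = Offline.majorityVote → d = 1)
    (ω : ZMod P.k → P.Param) :
    residualClass v tie (evolve v tie (P.noise d 0 ω) (P.n + 2)).err K = Pi.single 0 1 := by
  rw [err_evolve_noise tie hL ω]
  cases K with
  | messagePassing => exact residualClass_messagePassing tie hL' ω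
  | majorityVote =>
    have hd := hK rfl
    funext a
    have ha : a = 0 := by
      subst hd
      exact Subsingleton.elim _ _
    rw [ha, Pi.single_eq_same]
    exact if_pos (lt_two_mul_card_flipped ω)

end Layout

/-! ### Delayed noise -/

lemma syndrome_zero {d L : ℕ} : syndrome (0 : Chain d L) = 0 := by
  funext x
  simp [syndrome]

lemma step_fresh_zero {d L v : ℕ} (tie : TieBreak d) :
    step v tie 0 0 (State.fresh (0 : Chain d L)) = State.fresh 0 := by
  have hm : messageStep (0 : Site d L → ZMod 2) (fun _ _ => ⊤) = fun _ _ => ⊤ := by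
    funext D x
    simp [messageStep, truncate]
  have hit : (messageStep (0 : Site d L → ZMod 2))^[v] (fun _ _ => ⊤) = fun _ _ => ⊤ :=
    Function.iterate_fixed hm v
  have hf : feedback tie (0 : Site d L → ZMod 2) (fun _ _ => ⊤) = 0 := by
    funext ℓ
    refine if_neg ?_
    rintro ⟨x, h, -⟩
    exact zero_ne_one h
  unfold step State.fresh
  simp only [add_zero, syndrome_zero, hit, hf]

lemma evolve_of_empty {d L v : ℕ} (tie : TieBreak d) {N : Set (Loc d L)} {τ : ℕ}
    (h : ∀ u t, (u, t) ∈ N → τ ≤ t) : ∀ t ≤ τ, evolve v tie N t = State.fresh 0 := by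
  intro t
  induction t with
  | zero => intro _; rfl
  | succ t ih =>
    intro ht
    rw [evolve, ih (by omega)]
    have hno : ∀ u, (u, t) ∉ N := fun u hu => by have := h u t hu; omega
    simp only [hno, if_false]
    exact step_fresh_zero tie

lemma evolve_delay {d L v : ℕ} (tie : TieBreak d) {N N' : Set (Loc d L)} {τ : ℕ}
    (h : ∀ u t, (u, t) ∈ N' → τ ≤ t) (hN : ∀ u t, (u, t + τ) ∈ N' ↔ (u, t) ∈ N) (t : ℕ) :
    evolve v tie N' (t + τ) = evolve v tie N t := by
  induction t with
  | zero =>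
    rw [zero_add, evolve_of_empty tie h τ le_rfl]
    rfl
  | succ t ih =>
    rw [add_right_comm, evolve, evolve, ih]
    simp only [hN]

lemma residualClass_zero {d L v : ℕ} [NeZero L] (tie : TieBreak d) (K : Offline) :
    residualClass v tie (0 : Chain d L) K = 0 := by
  cases K with
  | messagePassing =>
    have h0 : syndrome (noiselessRun v tie (0 : Chain d L) 0).err = 0 := syndrome_zero
    have hex : ∃ n, syndrome (noiselessRun v tie (0 : Chain d L) n).err = 0 := ⟨0, h0⟩
    unfold residualClass
    simp only
    rw [dif_pos hex, (Nat.find_eq_zero hex).mpr h0]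
    funext a
    simp [winding, noiselessRun, State.fresh]
  | majorityVote =>
    funext a
    simp [residualClass]

/-! ### The logical channel -/

lemma logicalX_zero {d : ℕ} : logicalX (0 : Fin d → ZMod 2) = 1 := by
  ext i j
  simp [logicalX, Matrix.one_apply]

/-- If the residual class is certain, then the logical channel is a bit flip. -/
lemma logicalChannel_of_class {d L v : ℕ} [NeZero L] {tie : TieBreak d} {K : Offline}
    {Ω : Type} [Fintype Ω] [Nonempty Ω] {N : Ω → Set (Loc d L)} {t : ℕ} {c : Fin d → ZMod 2}
    (h : ∀ ω, residualClass v tie (evolve v tie (N ω) t).err K = c) (ρ : LogicalOp d) :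
    logicalChannel v tie K (uniformLaw N) t ρ = logicalX c * ρ * logicalX c := by
  unfold logicalChannel
  rw [Finset.sum_eq_single c]
  · rw [uniformLaw_eq_one (s := {N | residualClass v tie (evolve v tie N t).err K = c}) h]
    simp
  · intro c' _ hc'
    rw [uniformLaw_eq_zero (s := {N | residualClass v tie (evolve v tie N t).err K = c'})]
    · simp
    · intro ω hω
      exact hc' ((hω : _ = c').symm.trans (h ω))
  · simp

lemma traceNorm_zero {d : ℕ} : traceNorm (0 : LogicalOp d) = 0 := by
  unfold traceNorm
  refine Finset.sum_eq_zero fun i _ => ?_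
  have h := (Matrix.isHermitian_conjTranspose_mul_self (0 : LogicalOp d)).eigenvalues_eq_zero_iff.mpr
    (by simp)
  rw [h]
  simp

/-- The difference of two orthogonal projections of rank one has trace norm `2`. -/
lemma traceNorm_eq_two {d : ℕ} {c : Fin d → ZMod 2} (hc : c ≠ 0) :
    traceNorm (Matrix.diagonal (Pi.single c 1 - Pi.single 0 1) : LogicalOp d) = 2 := by
  set f : (Fin d → ZMod 2) → ℂ := Pi.single c 1 - Pi.single 0 1 with hf
  set A : LogicalOp d := Matrix.diagonal f with hA
  have hsq : ∀ i, star (f i) * f i = (Pi.single c 1 + Pi.single 0 1 : _ → ℂ) i := by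
    intro i
    rw [hf]
    by_cases h1 : i = c
    · subst h1
      simp [Pi.single_eq_of_ne hc]
    · by_cases h0 : i = 0
      · subst h0
        simp [Pi.single_eq_of_ne h1]
      · simp [Pi.single_eq_of_ne h1, Pi.single_eq_of_ne h0]
  have hAA : A.conjTranspose * A = Matrix.diagonal (Pi.single c 1 + Pi.single 0 1) := by
    rw [hA, Matrix.diagonal_conjTranspose, Matrix.diagonal_mul_diagonal]
    congr 1
    funext i
    exact hsq i
  have hidem : IsIdempotentElem (A.conjTranspose * A) := by
    rw [IsIdempotentElem, hAA, Matrix.diagonal_mul_diagonal]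
    congr 1
    funext i
    by_cases h1 : i = c
    · subst h1
      simp [Pi.single_eq_of_ne hc]
    · by_cases h0 : i = 0
      · subst h0
        simp [Pi.single_eq_of_ne h1]
      · simp [Pi.single_eq_of_ne h1, Pi.single_eq_of_ne h0]
  have hH := Matrix.isHermitian_conjTranspose_mul_self A
  have hsqrt : ∀ i, Real.sqrt (hH.eigenvalues i) = hH.eigenvalues i := by
    intro i
    have h1 := IsIdempotentElem.spectrum_subset ℝ hidem (hH.eigenvalues_mem_spectrum_real i)
    rcases h1 with h1 | h1
    · rw [h1]; simp
    · rw [Set.mem_singleton_iff] at h1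
      rw [h1]; simp
  have htr : (A.conjTranspose * A).trace = 2 := by
    rw [hAA, Matrix.trace_diagonal]
    simp only [Pi.add_apply, Finset.sum_add_distrib, Finset.sum_pi_single', Finset.mem_univ,
      if_true]
    norm_num
  rw [hH.trace_eq_sum_eigenvalues] at htr
  unfold traceNorm
  rw [Finset.sum_congr rfl fun i _ => hsqrt i]
  have hre := congrArg Complex.re htr
  simpa using hre

lemma isDensity_diagonal_single {d : ℕ} :
    IsDensity (Matrix.diagonal (Pi.single 0 1) : LogicalOp d) := by
  constructor
  · refine Matrix.PosSemidef.diagonal fun i => ?_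
    by_cases h : i = 0
    · subst h; simp
    · simp [Pi.single_eq_of_ne h]
  · rw [Matrix.trace_diagonal]
    simp

lemma logicalX_conj_single {d : ℕ} (c : Fin d → ZMod 2) :
    logicalX c * (Matrix.diagonal (Pi.single 0 1) : LogicalOp d) * logicalX c =
      Matrix.diagonal (Pi.single c 1) := by
  have hcc : ∀ x : Fin d → ZMod 2, x + x = 0 := fun x => by
    funext a
    exact CharTwo.add_self_eq_zero _
  ext i j
  rw [Matrix.mul_apply, Finset.sum_eq_single 0]
  · rw [Matrix.mul_diagonal]
    by_cases hi : i = c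
    · subst hi
      by_cases hj : j = i
      · subst hj
        simp [logicalX, hcc]
      · have h1 : ¬ (0 = j + i) := by
          intro h
          apply hj
          calc j = j + (i + i) := by rw [hcc, add_zero]
            _ = i := by rw [← add_assoc, ← h, zero_add]
        simp [logicalX, h1, Matrix.diagonal_apply_ne' _ hj]
    · by_cases hij : i = j
      · subst hij
        simp [logicalX, hi]
      · simp [logicalX, hi, Matrix.diagonal_apply_ne _ hij]
  · intro k _ hk
    rw [Matrix.mul_diagonal, Pi.single_eq_of_ne hk]
    simp
  · simp

/-! ### The memory time -/

/-- At time `t`, the logical channel moves some logical state by more than `1 / 2`. -/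
def FailsAt {d L : ℕ} [NeZero L] (v : ℕ) (tie : TieBreak d) (K : Offline)
    (P : Measure (Set (Loc d L))) (t : ℕ) : Prop :=
  ∃ ρ : LogicalOp d, IsDensity ρ ∧ 1 / 2 < traceNorm (logicalChannel v tie K P t ρ - ρ)

lemma memoryTime_eq {d L v : ℕ} [NeZero L] {tie : TieBreak d} {K : Offline}
    {P : Measure (Set (Loc d L))} {t₀ : ℕ} (h : FailsAt v tie K P t₀)
    (hmin : ∀ t < t₀, ¬ FailsAt v tie K P t) : memoryTime v tie K P = t₀ := by
  refine le_antisymm (sInf_le ⟨t₀, rfl, h⟩) (le_sInf ?_)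
  rintro _ ⟨t, rfl, ht⟩
  by_contra hlt
  exact hmin t (by exact_mod_cast not_le.mp hlt) ht

lemma failsAt_of_class {d L v : ℕ} [NeZero L] {tie : TieBreak d} {K : Offline}
    {Ω : Type} [Fintype Ω] [Nonempty Ω] {N : Ω → Set (Loc d L)} {t : ℕ} {c : Fin d → ZMod 2}
    (hc : c ≠ 0) (h : ∀ ω, residualClass v tie (evolve v tie (N ω) t).err K = c) :
    FailsAt v tie K (uniformLaw N) t := by
  refine ⟨_, isDensity_diagonal_single, ?_⟩
  rw [logicalChannel_of_class h, logicalX_conj_single, Matrix.diagonal_sub]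
  have := traceNorm_eq_two hc
  rw [show (fun i => (Pi.single c 1 : (Fin d → ZMod 2) → ℂ) i - (Pi.single 0 1 : _ → ℂ) i) =
    Pi.single c 1 - Pi.single 0 1 from rfl, this]
  norm_num

namespace Layout

variable {v L : ℕ} {P : Layout v L} {d : ℕ} [NeZero d]

lemma noise_delay (τ : ℕ) (ω : ZMod P.k → P.Param) (u : Link d L ⊕ Site d L) (t : ℕ) :
    (u, t + τ) ∈ P.noise d τ ω ↔ (u, t) ∈ P.noise d 0 ω := by
  rw [mem_noise, mem_noise]
  simp

lemma le_of_mem_noise (τ : ℕ) (ω : ZMod P.k → P.Param) (u : Link d L ⊕ Site d L) (t : ℕ)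
    (h : (u, t) ∈ P.noise d τ ω) : τ ≤ t := by
  obtain ⟨t', w, h, -⟩ := mem_noise.mp h
  rw [Prod.mk.injEq] at h
  omega

variable [NeZero L]

lemma failsAt_delay_iff (tie : TieBreak d) (K : Offline) (τ t : ℕ) :
    FailsAt v tie K (uniformLaw (P.noise d τ)) (t + τ) ↔
      FailsAt v tie K (uniformLaw (P.noise d 0)) t := by
  have h : ∀ ρ, logicalChannel v tie K (uniformLaw (P.noise d τ)) (t + τ) ρ =
      logicalChannel v tie K (uniformLaw (P.noise d 0)) t ρ := by
    intro ρ
    unfold logicalChannel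
    refine Finset.sum_congr rfl fun c _ => ?_
    rw [uniformLaw_apply, uniformLaw_apply]
    simp only [Set.mem_ofPred_eq, evolve_delay tie (le_of_mem_noise τ _) (noise_delay τ _)]
  unfold FailsAt
  simp only [h]

lemma not_failsAt_of_le (tie : TieBreak d) (K : Offline) {τ t : ℕ} (ht : t ≤ τ) :
    ¬ FailsAt v tie K (uniformLaw (P.noise d τ)) t := by
  rintro ⟨ρ, -, h⟩
  rw [logicalChannel_of_class (c := 0), logicalX_zero, one_mul, mul_one, sub_self,
    traceNorm_zero] at h
  · norm_num at h
  · intro ω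
    rw [evolve_of_empty tie (le_of_mem_noise τ ω) t ht]
    exact residualClass_zero tie K

/-- A delay of the noise delays the failure of the memory. -/
lemma memoryTime_delay {tie : TieBreak d} {K : Offline} {t₀ : ℕ}
    (h : memoryTime v tie K (uniformLaw (P.noise d 0)) = t₀)
    (τ : ℕ) : memoryTime v tie K (uniformLaw (P.noise d τ)) = (t₀ + τ : ℕ) := by
  have hfail : FailsAt v tie K (uniformLaw (P.noise d 0)) t₀ ∧
      ∀ t < t₀, ¬ FailsAt v tie K (uniformLaw (P.noise d 0)) t := by
    have hex : ∃ t, FailsAt v tie K (uniformLaw (P.noise d 0)) t := by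
      by_contra hno
      push Not at hno
      have htop : memoryTime v tie K (uniformLaw (P.noise d 0)) = ⊤ := by
        refine sInf_eq_top.mpr ?_
        rintro _ ⟨t, -, ht⟩
        exact absurd ht (hno t)
      rw [htop] at h
      exact ENat.top_ne_natCast _ h
    have h1 := memoryTime_eq (Nat.find_spec hex) fun t ht => Nat.find_min hex ht
    rw [h] at h1
    have h2 : t₀ = Nat.find hex := by exact_mod_cast h1
    rw [h2]
    exact ⟨Nat.find_spec hex, fun t ht => Nat.find_min hex ht⟩
  refine memoryTime_eq ((failsAt_delay_iff tie K τ t₀).mpr hfail.1) fun t ht => ?_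
  rcases le_total t τ with hle | hle
  · exact not_failsAt_of_le tie K hle
  · obtain ⟨t', rfl⟩ := Nat.exists_eq_add_of_le' hle
    rw [failsAt_delay_iff]
    exact hfail.2 t' (by omega)

lemma memoryTime_le (tie : TieBreak d) (hL : (P.n + 2) * v < L)
    (hL' : 2 * P.gapBound * v < L) (K : Offline) (hK : K = Offline.majorityVote → d = 1) :
    memoryTime v tie K (uniformLaw (P.noise d 0)) ≤ (P.n + 2 : ℕ) := by
  refine sInf_le ⟨_, rfl, failsAt_of_class (c := Pi.single 0 1) ?_
    (residualClass_noise tie hL hL' K hK)⟩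
  exact fun h => one_ne_zero (α := ZMod 2) (by simpa using congrFun h 0)

end Layout

/-! ### Choice of the parameters -/

/-- The number of choices that make a single fault cheap at noise strength `p`. -/
def placesFor (p : ℝ) : ℕ := ⌊2 / p⌋₊ + 1

/-- The number of sites among which the centre of a domain is chosen. -/
def centresFor (v m : ℕ) : ℕ := 37 * v * m * m ^ (4 * v + 2) * 3 ^ (4 * v * m)

/-- The number of time steps for which the domains grow. -/
def growthFor (v m : ℕ) : ℕ := 4 * m * v + 20 + 2 * centresFor v m

/-- The minimal length of a block. -/
def blockFor (v m : ℕ) : ℕ := 2 * (2 * v + growthFor v m + 2 * m * v + 11) + centresFor v m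

/-- The linear size from which on the line can be divided into blocks of lengths `blockFor v m` and
`blockFor v m + 1` that signals do not cross during the relevant time. -/
def sizeFor (v m : ℕ) : ℕ := blockFor v m * blockFor v m + 2 * (growthFor v m + 2) * v + 1

lemma placesFor_pos (p : ℝ) : 1 ≤ placesFor p := Nat.le_add_left _ _

lemma two_div_placesFor_lt {p : ℝ} (hp : 0 < p) : 2 / (placesFor p : ℝ) < p := by
  have h : 2 / p < placesFor p := by
    unfold placesFor
    push_cast
    exact Nat.lt_floor_add_one _
  rw [div_lt_iff₀ hp] at h
  rw [div_lt_iff₀ (by exact_mod_cast placesFor_pos p)]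
  linarith

/-- The layout used at noise strength `p` on large lattices. -/
def layoutFor {v L : ℕ} (hv : 1 ≤ v) (p : ℝ) (hL : sizeFor v (placesFor p) ≤ L) : Layout v L where
  m := placesFor p
  n := growthFor v (placesFor p)
  M := centresFor v (placesFor p)
  k := L / blockFor v (placesFor p)
  v_pos := hv
  m_pos := placesFor_pos p
  k_pos := by
    have h1 : 1 ≤ blockFor v (placesFor p) := by unfold blockFor; omega
    refine (Nat.one_le_div_iff h1).mpr (le_trans ?_ hL)
    unfold sizeFor
    have := Nat.le_mul_of_pos_left (blockFor v (placesFor p)) h1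
    omega
  M_ge := le_rfl
  n_ge := le_rfl
  length_ge := Nat.div_mul_le_self _ _
  length_le := by
    have h1 : 1 ≤ blockFor v (placesFor p) := by unfold blockFor; omega
    have h2 : blockFor v (placesFor p) ≤ L / blockFor v (placesFor p) := by
      refine (Nat.le_div_iff_mul_le h1).mpr (le_trans ?_ hL)
      unfold sizeFor
      omega
    have h3 := Nat.div_add_mod L (blockFor v (placesFor p))
    have h4 := Nat.mod_lt L h1
    change L ≤ L / blockFor v (placesFor p) * (blockFor v (placesFor p) + 1)
    rw [mul_comm] at h3
    rw [Nat.mul_add, mul_one]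
    omega

/-- The noise at strength `p`, delayed by `τ` time steps; there is none on small lattices. -/
def lawFor (d : ℕ) [NeZero d] {v : ℕ} (hv : 1 ≤ v) (p : ℝ) (L τ : ℕ) : Measure (Set (Loc d L)) :=
  if h : sizeFor v (placesFor p) ≤ L then uniformLaw ((layoutFor hv p h).noise d τ)
  else Measure.dirac ∅

section

variable {d v : ℕ} [NeZero d] (hv : 1 ≤ v) {p : ℝ} {L : ℕ} [NeZero L]

lemma isProbabilityMeasure_lawFor (τ : ℕ) : IsProbabilityMeasure (lawFor d hv p L τ) := by
  unfold lawFor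
  split_ifs
  · exact isProbabilityMeasure_uniformLaw _
  · exact Measure.dirac.isProbabilityMeasure

lemma pBounded_lawFor (hp : 0 < p) (hp1 : p < 1) (τ : ℕ) : PBounded p (lawFor d hv p L τ) := by
  unfold lawFor
  split_ifs with h
  · exact Layout.pBounded_noise (P := layoutFor hv p h) (two_div_placesFor_lt hp) hp1.le τ
  · intro A hA
    rw [Measure.dirac_apply, Set.indicator_of_notMem]
    · simpa using pow_pos hp A.card
    · intro hsub
      obtain ⟨a, ha⟩ := hA
      exact hsub (Finset.mem_coe.mpr ha)

lemma ae_subset_lineQubits_lawFor (τ : ℕ) : ∀ᵐ N ∂(lawFor d hv p L τ), N ⊆ lineQubits d L := by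
  rw [ae_iff]
  unfold lawFor
  split_ifs with h
  · refine uniformLaw_eq_zero fun ω hω => hω fun u hu => ?_
    obtain ⟨t, w, rfl, -⟩ := Layout.mem_noise.mp hu
    exact ⟨linePt d L w, fun b hb => by simp [linePt, Pi.single_eq_of_ne hb], rfl⟩
  · rw [Measure.dirac_apply, Set.indicator_of_notMem]
    intro hmem
    exact hmem (Set.empty_subset _)

lemma memoryTime_lawFor (tie : TieBreak d) (K : Offline)
    (hK : K = Offline.majorityVote → d = 1) (h : sizeFor v (placesFor p) ≤ L) :
    memoryTime v tie K (lawFor d hv p L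
      (growthFor v (placesFor p) + 2 - (memoryTime v tie K (lawFor d hv p L 0)).toNat)) =
      (growthFor v (placesFor p) + 2 : ℕ) := by
  have hsize := h
  unfold sizeFor at hsize
  have hn : (layoutFor hv p h).n = growthFor v (placesFor p) := rfl
  have hg : (layoutFor hv p h).gapBound = growthFor v (placesFor p) := rfl
  have h1 : 2 * (growthFor v (placesFor p) + 2) * v =
      2 * growthFor v (placesFor p) * v + 4 * v := by ring
  have h2 : (growthFor v (placesFor p) + 2) * v ≤ 2 * (growthFor v (placesFor p) + 2) * v :=
    Nat.mul_le_mul_right _ (by omega)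
  have hle : memoryTime v tie K (uniformLaw ((layoutFor hv p h).noise d 0)) ≤
      (growthFor v (placesFor p) + 2 : ℕ) :=
    Layout.memoryTime_le tie (by rw [hn]; omega) (by rw [hg]; omega) K hK
  have hlaw : ∀ τ, lawFor d hv p L τ = uniformLaw ((layoutFor hv p h).noise d τ) :=
    fun τ => dif_pos h
  rw [hlaw, hlaw 0]
  obtain ⟨t₀, ht₀⟩ := ENat.ne_top_iff_exists.mp (ne_top_of_le_ne_top (ENat.natCast_ne_top _) hle)
  rw [← ht₀] at hle ⊢
  have hle' : t₀ ≤ growthFor v (placesFor p) + 2 := by exact_mod_cast hle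
  rw [Layout.memoryTime_delay ht₀.symm, ENat.toNat_natCast]
  congr 1
  omega

end

/-- The base of the exponential in `m` that bounds the memory time. -/
def rate (v : ℕ) : ℝ := 2 * 2 ^ (4 * v + 2) * 3 ^ (4 * v)

lemma growthFor_le (v m : ℕ) : (growthFor v m : ℝ) + 2 ≤ (78 * v + 22) * rate v ^ m := by
  have h1 : m ≤ 2 ^ m := Nat.lt_two_pow_self.le
  have hc : centresFor v m ≤ 37 * v * (2 ^ m * (2 ^ m) ^ (4 * v + 2) * 3 ^ (4 * v * m)) := by
    unfold centresFor
    calc 37 * v * m * m ^ (4 * v + 2) * 3 ^ (4 * v * m)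
        ≤ 37 * v * 2 ^ m * (2 ^ m) ^ (4 * v + 2) * 3 ^ (4 * v * m) := by gcongr
      _ = _ := by ring
  have hQ : (2 ^ m * (2 ^ m) ^ (4 * v + 2) * 3 ^ (4 * v * m) : ℝ) = rate v ^ m := by
    unfold rate
    rw [mul_pow, mul_pow, ← pow_mul, ← pow_mul, ← pow_mul]
    congr 3
    ring
  have h2 : 2 ^ m ≤ 2 ^ m * (2 ^ m) ^ (4 * v + 2) * 3 ^ (4 * v * m) := by
    rw [mul_assoc]
    exact Nat.le_mul_of_pos_right _ (by positivity)
  set X := 2 ^ m * (2 ^ m) ^ (4 * v + 2) * 3 ^ (4 * v * m) with hX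
  have hX1 : 1 ≤ X := le_trans Nat.one_le_two_pow h2
  have h3 : m * v ≤ X * v := Nat.mul_le_mul_right v (h1.trans h2)
  have h4 : growthFor v m + 2 ≤ (78 * v + 22) * X := by
    unfold growthFor
    have e1 : 4 * m * v = 4 * (m * v) := by ring
    have e2 : (78 * v + 22) * X = 4 * (X * v) + 22 * X + 2 * (37 * v * X) := by ring
    omega
  rw [← hQ]
  exact_mod_cast h4

/-- Since `p = 1 - e ^ (-y)` with `y = ln (1 / (1 - p))`, one has `1 / p ≤ 1 + 1 / y`. -/
lemma placesFor_le {p : ℝ} (hp : 0 < p) (hp1 : p < 1) :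
    (placesFor p : ℝ) ≤ 2 * (1 / Real.log (1 / (1 - p))) + 3 := by
  have h0 : 0 < 1 - p := by linarith
  set y := Real.log (1 / (1 - p)) with hy
  have hypos : 0 < y := Real.log_pos (by rw [lt_div_iff₀ h0]; linarith)
  have h1 : y + 1 ≤ 1 / (1 - p) := by
    have := Real.add_one_le_exp y
    rwa [hy, Real.exp_log (by positivity), ← hy] at this
  rw [le_div_iff₀ h0] at h1
  have h2 : 1 / p ≤ 1 + 1 / y := by
    rw [div_le_iff₀ hp]
    have : (1 + 1 / y) * p = (p * y + p) / y := by field_simp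
    rw [this, le_div_iff₀ hypos]
    nlinarith
  have h3 : (⌊2 / p⌋₊ : ℝ) ≤ 2 / p := Nat.floor_le (by positivity)
  unfold placesFor
  push_cast
  have h4 : 2 / p = 2 * (1 / p) := by ring
  linarith

lemma one_lt_rate (v : ℕ) : 1 < rate v := by
  unfold rate
  have h1 : (1 : ℝ) ≤ 2 ^ (4 * v + 2) := one_le_pow₀ (by norm_num)
  have h2 : (1 : ℝ) ≤ 3 ^ (4 * v) := one_le_pow₀ (by norm_num)
  nlinarith

lemma growthFor_lt {v : ℕ} {p : ℝ} (hp : 0 < p) (hp1 : p < 1) :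
    ((growthFor v (placesFor p) + 2 : ℕ) : ℝ) <
      (78 * v + 22) * rate v ^ 3 *
        Real.exp (2 * Real.log (rate v) / Real.log (1 / (1 - p))) + 1 := by
  have h1 := growthFor_le v (placesFor p)
  have hr := (one_lt_rate v).le
  have h2 : rate v ^ placesFor p ≤
      rate v ^ 3 * Real.exp (2 * Real.log (rate v) / Real.log (1 / (1 - p))) := by
    rw [← Real.rpow_natCast]
    refine (Real.rpow_le_rpow_of_exponent_le hr (placesFor_le hp hp1)).trans (le_of_eq ?_)
    have hpos : 0 < rate v := by linarith
    rw [add_comm, Real.rpow_add hpos, Real.rpow_def_of_pos hpos (2 * _)]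
    congr 1
    · exact_mod_cast Real.rpow_natCast (rate v) 3
    · congr 1
      ring
  push_cast
  have h3 := mul_le_mul_of_nonneg_left h2 (show (0 : ℝ) ≤ 78 * v + 22 by positivity)
  rw [← mul_assoc] at h3
  linarith

end MessagePassing

end

theorem theorem1 (d : ℕ) [NeZero d] (v : ℕ) (hv : 1 ≤ v) (tie : MessagePassing.TieBreak d)
    (K : MessagePassing.Offline) (hK : K = MessagePassing.Offline.majorityVote → d = 1) :
    ∃ a b c : ℝ, 0 < a ∧ 0 < b ∧ 0 < c ∧
      ∃ 𝓔 : ℝ → (L : ℕ+) → Measure (Set (MessagePassing.Loc d (L : ℕ))),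
        (∀ p : ℝ, 0 < p → p < 1 →
          (∀ L : ℕ+, IsProbabilityMeasure (𝓔 p L) ∧
            MessagePassing.PBounded p (𝓔 p L) ∧
            ∀ᵐ N ∂(𝓔 p L), N ⊆ MessagePassing.lineQubits d (L : ℕ)) ∧
          ∃ T : ℕ,
            Tendsto (fun L : ℕ+ => MessagePassing.memoryTime v tie K (𝓔 p L)) atTop
              (𝓝 (T : ℕ∞)) ∧
            (T : ℝ) < a * Real.exp (b / Real.log (1 / (1 - p))) + c) ∧
        ∀ p_c : ℝ, 0 < p_c →
          ¬ MessagePassing.HasThresholdAt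
            (fun p L => MessagePassing.memoryTime v tie K (𝓔 p L)) p_c := by
  open MessagePassing in
  have hlog := Real.log_pos (one_lt_rate v)
  have hpos : 0 < rate v := zero_lt_one.trans (one_lt_rate v)
  -- the delay makes the memory time the same for all large `L`
  set 𝓔 : ℝ → (L : ℕ+) → Measure (Set (Loc d (L : ℕ))) := fun p L =>
    lawFor d hv p L (growthFor v (placesFor p) + 2 -
      (memoryTime v tie K (lawFor d hv p L 0)).toNat) with hE
  have hlim : ∀ p : ℝ, Tendsto (fun L : ℕ+ => memoryTime v tie K (𝓔 p L)) atTop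
      (𝓝 ((growthFor v (placesFor p) + 2 : ℕ) : ℕ∞)) := by
    intro p
    refine tendsto_const_nhds.congr' ?_
    filter_upwards [eventually_ge_atTop (Nat.toPNat' (sizeFor v (placesFor p)))] with L hL
    refine (memoryTime_lawFor hv tie K hK ?_).symm
    have h1 : ((Nat.toPNat' (sizeFor v (placesFor p)) : ℕ+) : ℕ) ≤ L := by exact_mod_cast hL
    rw [Nat.toPNat'_coe] at h1
    split_ifs at h1 <;> omega
  refine ⟨(78 * v + 22) * rate v ^ 3, 2 * Real.log (rate v), 1, by positivity, by positivity,
    one_pos, 𝓔, fun p hp hp1 => ⟨fun L => ⟨isProbabilityMeasure_lawFor hv _,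
      pBounded_lawFor hv hp hp1 _, ae_subset_lineQubits_lawFor hv _⟩, _, hlim p,
      growthFor_lt hp hp1⟩, ?_⟩
  intro p_c hp hthr
  have h1 := hthr (p_c / 2) (by linarith) (by linarith)
  exact ENat.top_ne_natCast _ (tendsto_nhds_unique h1 (hlim (p_c / 2)))
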